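/- Let $d\ge 1$ and let $X$ be a finite $d$-dimensional simplicial complex (so it has a $d$-dimensional cell and no cell of larger dimension) with complete $(d-1)$-skeleton, i.e. every set of $d$ vertices is a cell. Write $X^{(i)}$ for the set of $i$-dimensional cells (with $X^{(-1)}=\{\varnothing\}$), and let $k$ be the average degree of a $(d-1)$-cell, i.e. the average over $\sigma\in X^{(d-1)}$ of the number of $d$-cells containing $\sigma$. Let $\Delta_{d-1}=\partial_d\delta_{d-1}+\delta_{d-2}\partial_{d-1}$ be the Laplacian on real $(d-1)$-chains, and let $Z_{d-1}(X,\mathbb R)=\ker\partial_{d-1}$. Suppose that, for a real number $\varepsilon$, $$\operatorname{Spec}\bigl(\Delta_{d-1}|_{Z_{d-1}(X,\mathbb R)}\bigr)\subseteq[k-\varepsilon,k+\varepsilon].$$ Let $c_d$ be the constant of Pach's theorem, i.e. the largest real number $c$ such that for any pairwise disjoint finite sets $P_1,\dots,P_{d+1}\subset\mathbb R^d$ whose union is in general position (any at most $d+1$ of its points are affinely independent) there are a point $z\in\mathbb R^d$ and subsets $Q_i\subseteq P_i$ with $|Q_i|\ge c\,|P_i|$ such that $z$ lies in every $d$-simplex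 with exactly one vertex in each $Q_i$. (This maximum exists; that it is positive is Pach's theorem.) Then $X$ has geometric overlap at least $$\eta=\frac{c_d^{\,d}}{e^{d+1}}\left(c_d-\frac{\varepsilon(d+1)}{k}\right),$$ that is: for every injective map $\varphi:X^{(0)}\to\mathbb R^d$ with geometric extension $\widetilde\varphi:X\to\mathbb R^d$ (the extension that is affine on every simplex), there is a point $z\in\mathbb R^d$ such that $\widetilde\varphi^{-1}(z)$ intersects at least $\eta\,|X^{(d)}|$ of the $d$-dimensional simplices of $X$. -/

import Mathlib

/-! ### Finite simplicial complexes, cochains and the Laplacian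

`X : AbstractSimplicialComplex V` is a finite simplicial complex whose vertex set is the finite
linearly ordered type `V`. Mathlib records only the nonempty faces; the empty set is the unique
cell of dimension `-1`. -/

namespace AbstractSimplicialComplex

section Complex

variable {V : Type*}

/-- A (possibly empty) face of `X`. -/
def IsFace (X : AbstractSimplicialComplex V) (s : Finset V) : Prop :=
  s = ∅ ∨ s ∈ X

theorem IsFace.mono {X : AbstractSimplicialComplex V} {s t : Finset V}
    (hs : X.IsFace s) (hts : t ⊆ s) : X.IsFace t := by
  rcases t.eq_empty_or_nonempty with rfl | ht
  · exact Or.inl rfl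
  · rcases hs with rfl | hs
    · exact Or.inl (Finset.subset_empty.mp hts)
    · exact Or.inr ((X.isRelLowerSet_faces hs).2 hts ht)

/-- `X` has dimension `d`: there is a face with `d + 1` vertices and none with more. -/
def HasDimension (X : AbstractSimplicialComplex V) (d : ℕ) : Prop :=
  (∀ s : Finset V, X.IsFace s → s.card ≤ d + 1) ∧ ∃ s : Finset V, X.IsFace s ∧ s.card = d + 1

/-- The `i`-skeleton of `X` is complete: every set of `i + 1` vertices is a face. -/
def HasCompleteSkeleton (X : AbstractSimplicialComplex V) (i : ℤ) : Prop :=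
  ∀ s : Finset V, (s.card : ℤ) = i + 1 → X.IsFace s

variable [Fintype V]

open Classical in
/-- The set `X⁽ⁱ⁾` of `i`-dimensional cells: the faces with `i + 1` vertices. -/
noncomputable def cells (X : AbstractSimplicialComplex V) (i : ℤ) : Finset (Finset V) :=
  Finset.univ.filter fun s => X.IsFace s ∧ (s.card : ℤ) = i + 1

theorem mem_cells {X : AbstractSimplicialComplex V} {i : ℤ} {s : Finset V} :
    s ∈ X.cells i ↔ X.IsFace s ∧ (s.card : ℤ) = i + 1 := by
  classical
  simp [cells]

open Classical in
/-- The degree of an `i`-cell: the number of `(i + 1)`-cells containing it. -/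
noncomputable def degree (X : AbstractSimplicialComplex V) (i : ℤ) (s : Finset V) : ℕ :=
  ((X.cells (i + 1)).filter fun t => s ⊆ t).card

/-- The average degree of an `i`-cell. -/
noncomputable def averageDegree (X : AbstractSimplicialComplex V) (i : ℤ) : ℝ :=
  (∑ s ∈ X.cells i, (X.degree i s : ℝ)) / ((X.cells i).card : ℝ)

/-- Real `i`-chains, identified with real `i`-cochains: functions on the set of `i`-cells. -/
abbrev Chain (X : AbstractSimplicialComplex V) (i : ℤ) : Type _ :=
  {s : Finset V // s ∈ X.cells i} → ℝ

end Complex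

section Laplacian

variable {V : Type*} [LinearOrder V]

/-- The oriented incidence number `[F : G]`: if `G` arises from `F = {v₀ < v₁ < ⋯}` by removing
the vertex `v_ℓ` then it is `(-1) ^ ℓ`, and otherwise it is `0`. -/
def incidence (F G : Finset V) : ℝ :=
  ∑ v ∈ F, if F.erase v = G then (-1) ^ (F.filter (· < v)).card else 0

theorem incidence_eq_zero {F G : Finset V} (h : ∀ v ∈ F, F.erase v ≠ G) : incidence F G = 0 :=
  Finset.sum_eq_zero fun v hv => if_neg (h v hv)

theorem sign_erase {F : Finset V} {u v : V} (hv : v ∈ F) :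
    (-1 : ℝ) ^ ((F.erase v).filter (· < u)).card
      = (if v < u then -1 else 1) * (-1) ^ (F.filter (· < u)).card := by
  rw [Finset.filter_erase]
  split_ifs with h
  · have hm : v ∈ F.filter (· < u) := Finset.mem_filter.mpr ⟨hv, h⟩
    have hc := Finset.card_erase_add_one hm
    rw [← hc, pow_succ]
    ring
  · rw [Finset.erase_eq_of_notMem (by simp [h]), one_mul]

theorem sum_sum_erase (F H : Finset V) :
    ∑ v ∈ F, (-1 : ℝ) ^ (F.filter (· < v)).card * incidence (F.erase v) H = 0 := by
  set s : V → ℝ := fun v => (-1) ^ (F.filter (· < v)).card with hs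
  set g : V → V → ℝ := fun v u =>
    if u ≠ v ∧ (F.erase v).erase u = H then s v * ((if v < u then -1 else 1) * s u) else 0 with hg
  have key : ∑ v ∈ F, s v * incidence (F.erase v) H = ∑ v ∈ F, ∑ u ∈ F, g v u := by
    refine Finset.sum_congr rfl fun v hv => ?_
    rw [incidence, Finset.mul_sum]
    rw [← Finset.sum_erase F (f := fun u => g v u) (a := v) (by simp [hg])]
    refine Finset.sum_congr rfl fun u hu => ?_
    have huv : u ≠ v := Finset.ne_of_mem_erase hu
    simp only [hg, huv, ne_eq, not_false_eq_true, true_and]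
    split_ifs with h1 h2
    · rw [sign_erase hv, if_pos h2]
    · rw [sign_erase hv, if_neg h2]
    · simp
  have anti : ∀ v u, g v u = - g u v := by
    intro v u
    simp only [hg]
    by_cases huv : u = v
    · simp [huv]
    · have hvu : ¬ v = u := fun h => huv h.symm
      rw [Finset.erase_right_comm (a := u) (b := v)]
      simp only [huv, hvu, ne_eq, not_false_eq_true, true_and]
      split_ifs with h1 h2 h3 h3
      · exact absurd h2 (lt_asymm h3)
      · ring
      · ring
      · exact absurd (lt_of_le_of_ne (not_lt.mp h2) huv) h3
      · simp
  rw [key]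
  have hswap : ∑ v ∈ F, ∑ u ∈ F, g v u = - ∑ v ∈ F, ∑ u ∈ F, g v u := by
    conv_lhs => rw [Finset.sum_comm]
    simp only [← Finset.sum_neg_distrib]
    exact Finset.sum_congr rfl fun u _ => Finset.sum_congr rfl fun v _ => anti v u
  linarith

variable [Fintype V]

/-- The coboundary map `Cⁱ → Cʲ`, `(δ f)(F) = ∑_G [F : G] f(G)`, used for `j = i + 1`
(for other `j` it is zero). -/
noncomputable def coboundary (X : AbstractSimplicialComplex V) (i j : ℤ) :
    X.Chain i →ₗ[ℝ] X.Chain j where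
  toFun f F := ∑ G : {s : Finset V // s ∈ X.cells i}, incidence F.1 G.1 * f G
  map_add' f g := by
    funext F
    simp [mul_add, Finset.sum_add_distrib]
  map_smul' a f := by
    funext F
    simp [Finset.mul_sum, mul_left_comm]

/-- The boundary map `Cᵢ → Cⱼ` sending a cell `F` to `∑_G [F : G] G`, used for `j = i - 1`
(for other `j` it is zero). -/
noncomputable def boundary (X : AbstractSimplicialComplex V) (i j : ℤ) :
    X.Chain i →ₗ[ℝ] X.Chain j where
  toFun f G := ∑ F : {s : Finset V // s ∈ X.cells i}, incidence F.1 G.1 * f F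
  map_add' f g := by
    funext F
    simp [mul_add, Finset.sum_add_distrib]
  map_smul' a f := by
    funext F
    simp [Finset.mul_sum, mul_left_comm]

theorem sum_incidence_mul_incidence (X : AbstractSimplicialComplex V) {i j : ℤ} (F H : Finset V)
    (hF : F ∈ X.cells i) :
    ∑ G : {s : Finset V // s ∈ X.cells j}, incidence G.1 H * incidence F G.1 = 0 := by
  rw [Finset.sum_coe_sort (X.cells j) fun G => incidence G H * incidence F G]
  obtain ⟨hFf, hFc⟩ := mem_cells.mp hF
  by_cases hij : j = i - 1
  · have hmem : ∀ v ∈ F, F.erase v ∈ X.cells j := by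
      intro v hv
      refine mem_cells.mpr ⟨hFf.mono (Finset.erase_subset v F), ?_⟩
      have := Finset.card_erase_add_one hv
      omega
    rw [← sum_sum_erase F H]
    simp only [incidence.eq_1 F, Finset.mul_sum]
    rw [Finset.sum_comm]
    refine Finset.sum_congr rfl fun v hv => ?_
    rw [Finset.sum_eq_single_of_mem (F.erase v) (hmem v hv)]
    · rw [if_pos rfl, mul_comm]
    · intro G _ hG
      rw [if_neg (Ne.symm hG), mul_zero]
  · refine Finset.sum_eq_zero fun G hG => ?_
    rw [incidence_eq_zero (F := F) (G := G), mul_zero]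
    rintro v hv rfl
    have h1 := Finset.card_erase_add_one hv
    have h2 := (mem_cells.mp hG).2
    omega

theorem boundary_boundary (X : AbstractSimplicialComplex V) (i j k : ℤ) (f : X.Chain i) :
    X.boundary j k (X.boundary i j f) = 0 := by
  funext H
  simp only [boundary, LinearMap.coe_mk, AddHom.coe_mk, Finset.mul_sum, Pi.zero_apply]
  rw [Finset.sum_comm]
  refine Finset.sum_eq_zero fun F _ => ?_
  simp only [← mul_assoc]
  rw [← Finset.sum_mul, sum_incidence_mul_incidence X F.1 H.1 F.2, zero_mul]

/-- The `i`-th Laplacian `Δᵢ = ∂ᵢ₊₁ δᵢ + δᵢ₋₁ ∂ᵢ`. -/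
noncomputable def laplacian (X : AbstractSimplicialComplex V) (i : ℤ) :
    X.Chain i →ₗ[ℝ] X.Chain i :=
  X.boundary (i + 1) i ∘ₗ X.coboundary i (i + 1) + X.coboundary (i - 1) i ∘ₗ X.boundary i (i - 1)

/-- The space of `i`-cycles `Zᵢ(X, ℝ) = ker ∂ᵢ`. -/
noncomputable def cycles (X : AbstractSimplicialComplex V) (i : ℤ) : Submodule ℝ (X.Chain i) :=
  LinearMap.ker (X.boundary i (i - 1))

theorem laplacian_mem_cycles (X : AbstractSimplicialComplex V) (i : ℤ) :
    ∀ f ∈ X.cycles i, X.laplacian i f ∈ X.cycles i := by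
  intro f hf
  have hf' : X.boundary i (i - 1) f = 0 := hf
  change X.boundary i (i - 1) (X.laplacian i f) = 0
  simp [laplacian, hf', boundary_boundary]

/-- The restriction `Δᵢ|_{Zᵢ(X, ℝ)}` as an endomorphism of the space of `i`-cycles. -/
noncomputable def laplacianOnCycles (X : AbstractSimplicialComplex V) (i : ℤ) :
    Module.End ℝ (X.cycles i) :=
  (X.laplacian i).restrict (X.laplacian_mem_cycles i)

/-- The spectrum of `Δᵢ|_{Zᵢ(X, ℝ)}`. -/
noncomputable def cycleSpectrum (X : AbstractSimplicialComplex V) (i : ℤ) : Set ℝ :=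
  spectrum ℝ (X.laplacianOnCycles i)

end Laplacian

/-! ### Geometric extensions and geometric overlap -/

section Overlap

variable {V : Type*} [Fintype V]

open Classical in
/-- `X` as a topological space: the points given by barycentric coordinates `w` on the vertices
whose support is a face. -/
def realization (X : AbstractSimplicialComplex V) : Set (V → ℝ) :=
  {w | w ∈ stdSimplex ℝ V ∧ X.IsFace (Finset.univ.filter fun v => w v ≠ 0)}

/-- The points of the realization of `X` that lie in the (closed) simplex `σ`. -/
def simplex (X : AbstractSimplicialComplex V) (σ : Finset V) : Set X.realization :=
  {w | ∀ v, v ∉ σ → w.1 v = 0}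

/-- The geometric extension of a map `φ` on the vertices: affine on every simplex of `X`. -/
def geometricExtension {d : ℕ} (X : AbstractSimplicialComplex V)
    (φ : V → EuclideanSpace ℝ (Fin d)) : X.realization → EuclideanSpace ℝ (Fin d) :=
  fun w => ∑ v, w.1 v • φ v

open Classical in
/-- The `d`-dimensional complex `X` has `η`-geometric overlap: for every injective map `φ` of the
vertices to `ℝᵈ`, with geometric extension `φ'`, there is a point `z` such that `φ' ⁻¹(z)`
intersects at least `η * |X⁽ᵈ⁾|` of the `d`-simplices of `X`.
(For `η ≤ 0` this holds trivially.) -/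
def HasGeometricOverlap (X : AbstractSimplicialComplex V) (d : ℕ) (η : ℝ) : Prop :=
  ∀ φ : V → EuclideanSpace ℝ (Fin d), Function.Injective φ →
    ∃ z : EuclideanSpace ℝ (Fin d),
      η * ((X.cells d).card : ℝ) ≤
        (((X.cells d).filter fun σ =>
          (X.geometricExtension φ ⁻¹' {z} ∩ X.simplex σ).Nonempty).card : ℝ)

end Overlap

end AbstractSimplicialComplex

/-! ### The constant of Pach's theorem -/

namespace Pach

/-- A set of points of `ℝᵈ` is in general position: any at most `d + 1` of its points are
affinely independent. -/
def GeneralPosition {d : ℕ} (S : Set (EuclideanSpace ℝ (Fin d))) : Prop :=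
  ∀ T : Finset (EuclideanSpace ℝ (Fin d)), (T : Set (EuclideanSpace ℝ (Fin d))) ⊆ S →
    T.card ≤ d + 1 → AffineIndependent ℝ ((↑) : T → EuclideanSpace ℝ (Fin d))

/-- The constant `c` is admissible in Pach's theorem in `ℝᵈ`: for any `d + 1` disjoint finite
sets `P₀, …, P_d` whose union is in general position there are a point `z` and subsets `Qᵢ ⊆ Pᵢ`
with `|Qᵢ| ≥ c |Pᵢ|`, such that every `d`-simplex with exactly one vertex in each `Qᵢ`
contains `z`. -/
def IsAdmissible (d : ℕ) (c : ℝ) : Prop :=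
  ∀ P : Fin (d + 1) → Finset (EuclideanSpace ℝ (Fin d)),
    Pairwise (fun i j => Disjoint (P i) (P j)) →
    GeneralPosition (⋃ i, (P i : Set (EuclideanSpace ℝ (Fin d)))) →
    ∃ (z : EuclideanSpace ℝ (Fin d)) (Q : Fin (d + 1) → Finset (EuclideanSpace ℝ (Fin d))),
      (∀ i, Q i ⊆ P i) ∧ (∀ i, c * ((P i).card : ℝ) ≤ ((Q i).card : ℝ)) ∧
        ∀ x : Fin (d + 1) → EuclideanSpace ℝ (Fin d), (∀ i, x i ∈ Q i) →
          z ∈ convexHull ℝ (Set.range x)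

/-- The constant `c_d` of Pach's theorem: the largest admissible constant. -/
noncomputable def pachConstant (d : ℕ) : ℝ :=
  sSup {c : ℝ | IsAdmissible d c}

theorem isAdmissible_zero (d : ℕ) : IsAdmissible d 0 := by
  intro P _ _
  exact ⟨0, fun _ => ∅, by simp, by simp, fun x hx => absurd (hx 0) (by simp)⟩

theorem IsAdmissible.le_one {d : ℕ} {c : ℝ} (hc : IsAdmissible d c) : c ≤ 1 := by
  obtain ⟨p, hp⟩ : ∃ p : Fin (d + 1) → EuclideanSpace ℝ (Fin d), AffineIndependent ℝ p := by
    obtain ⟨b⟩ := AffineBasis.exists_affineBasis_of_finiteDimensional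
      (ι := Fin (d + 1)) (k := ℝ) (P := EuclideanSpace ℝ (Fin d)) (by simp)
    exact ⟨b, b.ind⟩
  obtain ⟨z, Q, hQP, hQ, -⟩ := hc (fun i => {p i})
    (fun i j hij => by simpa using fun h => hij (hp.injective h)) (by
      intro T hT _
      refine (hp.range).mono fun x hx => ?_
      obtain ⟨i, hi⟩ := Set.mem_iUnion.mp (hT hx)
      exact ⟨i, by simpa using Eq.symm (by simpa using hi)⟩)
  have h1 := hQ 0
  have h2 := Finset.card_le_card (hQP 0)
  have h3 : ((Q 0).card : ℝ) ≤ 1 := by exact_mod_cast (by simpa using h2)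
  simpa using h1.trans h3

/-- The constant `c_d` is itself admissible, and it is the largest admissible constant. -/
theorem isGreatest_pachConstant (d : ℕ) : IsGreatest {c : ℝ | IsAdmissible d c} (pachConstant d) := by
  have hbdd : BddAbove {c : ℝ | IsAdmissible d c} := ⟨1, fun c hc => IsAdmissible.le_one hc⟩
  have hne : {c : ℝ | IsAdmissible d c}.Nonempty := ⟨0, isAdmissible_zero d⟩
  refine ⟨?_, fun c hc => le_csSup hbdd hc⟩
  intro P hP hG
  obtain ⟨u, -, hu, hmem⟩ := exists_seq_tendsto_sSup hne hbdd
  choose z Q hQP hQ hz using fun n => hmem n P hP hG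
  let S : Finset (Fin (d + 1) → Finset (EuclideanSpace ℝ (Fin d))) :=
    Fintype.piFinset fun i => (P i).powerset
  have hS : ∀ n, Q n ∈ (S : Set _) := fun n => by
    simp only [S, Finset.mem_coe, Fintype.mem_piFinset, Finset.mem_powerset]
    exact hQP n
  obtain ⟨Q', hQ', hfreq⟩ : ∃ Q', Q' ∈ S ∧ ∃ᶠ n in Filter.atTop, Q n = Q' := by
    by_contra hcon
    push Not at hcon
    have hall := (Filter.eventually_all_finset S).mpr hcon
    obtain ⟨n, hn⟩ := hall.exists
    exact hn (Q n) (hS n) rfl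
  obtain ⟨n, hn⟩ := hfreq.exists
  refine ⟨z n, Q', hn ▸ hQP n, fun i => ?_, hn ▸ hz n⟩
  refine le_of_tendsto_of_frequently (hu.mul_const _) (hfreq.mono fun m hm => ?_)
  have := hQ m i
  rwa [hm] at this

end Pach

/-!
Forms on the vertex set (functions of finite vertex sets) carry the exterior multiplication
`wedge a` and its adjoint `contract a`. They satisfy the Clifford relation
`contract_wedge_add_wedge_contract`, so the Laplacian of the full simplex on the `n` vertices is
multiplication by `n`, and the projection to the cycles is `n⁻¹ ∂δ`. As `X` has a complete
`(d - 1)`-skeleton, the spectral hypothesis becomes `abs_sum_cells_wedge_sub_le`: for forms `φ`, `ψ`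
of degree `d`, the sum of `δφ δψ` over the `d`-cells of `X` differs from `k / n` times the sum over
all sets of `d + 1` vertices by at most `ε / n * ‖δφ‖ * ‖δψ‖`.

This has two consequences. Applied to single cells and averaged, it gives `k d ≤ ε (n - d)`
(`averageDegree_mul_le`). Applied to the product forms `1_A ∧ ω` and `1_B ∧ ω`, where `ω` is the
wedge product of the indicators of the other `d - 1` sets, it bounds from below the number of
`d`-cells with one vertex in each of `d + 1` disjoint sets of size `a`
(`card_transversal_cells_ge`): the product of the two coboundaries is `-1` at these cells and `0`
elsewhere (`wedge_one_productForm_mul`).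

Given a map `φ` of the vertices to `ℝᵈ`, Pach's theorem, extended to arbitrary position by a
perturbation and compactness (`Pach.exists_point_and_subsets`), is applied to `d + 1` disjoint sets
of exactly `q = ⌊n / (d + 1)⌋` vertices. It yields a point `z` and subsets of common size
`a ≥ c_d q` such that every simplex with one vertex in each subset contains `z`, so all the counted
cells meet the fibre of `z`. When `d + 1` does not divide `n` the parts are smaller than
`n / (d + 1)`. This loss is compensated in `overlap_bound_le`: the norm of `δφ` is smaller than that
of `√n φ`, by a factor `√(1 - d a / n)`, and `ε` is at least `k d / (n - d)`. Unless the claim is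
trivial, the same bound makes `n - d` at least `d (d + 1)`, which is what the comparison of `q ^ d`
with the number of `d`-subsets requires (`choose_le_exp_mul_pow`).
-/

namespace AbstractSimplicialComplex

/-! ### Wedge product and contraction on functions of finite sets -/

section Wedge

variable {V : Type*} [LinearOrder V]

/-- The sign with which the vertex `v` enters the cell `F`. -/
def vertexSign (v : V) (F : Finset V) : ℝ :=
  (-1) ^ (F.filter (· < v)).card

theorem vertexSign_mul_self (v : V) (F : Finset V) : vertexSign v F * vertexSign v F = 1 := by
  rw [vertexSign, ← mul_pow]; simp

theorem vertexSign_erase {F : Finset V} {u v : V} (hv : v ∈ F) :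
    vertexSign u (F.erase v) = (if v < u then -1 else 1) * vertexSign u F :=
  sign_erase hv

theorem vertexSign_insert {F : Finset V} {u v : V} (hv : v ∉ F) :
    vertexSign u (insert v F) = (if v < u then -1 else 1) * vertexSign u F := by
  have h := vertexSign_erase (F := insert v F) (u := u) (Finset.mem_insert_self v F)
  rw [Finset.erase_insert hv] at h
  rw [h]
  split_ifs <;> simp

/-- The wedge product `a ∧ φ` of a `1`-form `a` with a form `φ`. A form is a function on all finite
sets of vertices, the set `{v₀ < v₁ < ⋯}` standing for the basis form `v₀ ∧ v₁ ∧ ⋯`. -/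
def wedge (a : V → ℝ) (φ : Finset V → ℝ) : Finset V → ℝ :=
  fun F => ∑ v ∈ F, vertexSign v F * a v * φ (F.erase v)

theorem wedge_add_left (a b : V → ℝ) (φ : Finset V → ℝ) :
    wedge (a + b) φ = wedge a φ + wedge b φ := by
  funext F
  simp [wedge, mul_add, add_mul, Finset.sum_add_distrib]

theorem wedge_smul_right (a : V → ℝ) (r : ℝ) (φ : Finset V → ℝ) :
    wedge a (r • φ) = r • wedge a φ := by
  funext F
  simp only [wedge, Pi.smul_apply, smul_eq_mul, Finset.mul_sum]
  exact Finset.sum_congr rfl fun v _ => by ring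

theorem wedge_wedge_comm (a b : V → ℝ) (φ : Finset V → ℝ) :
    wedge a (wedge b φ) = -wedge b (wedge a φ) := by
  have expand : ∀ (a b : V → ℝ) (F : Finset V), wedge a (wedge b φ) F =
      ∑ v ∈ F, ∑ u ∈ F, if u = v then 0 else
        (if v < u then -1 else 1) * vertexSign v F * vertexSign u F * a v * b u *
          φ ((F.erase v).erase u) := by
    intro a b F
    refine Finset.sum_congr rfl fun v hv => ?_
    rw [wedge, Finset.mul_sum]
    conv_rhs => rw [← Finset.sum_erase F (a := v) (by simp)]
    refine Finset.sum_congr rfl fun u hu => ?_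
    rw [if_neg (Finset.ne_of_mem_erase hu), vertexSign_erase hv]
    ring
  funext F
  rw [Pi.neg_apply, expand a b, expand b a, Finset.sum_comm, ← Finset.sum_neg_distrib]
  refine Finset.sum_congr rfl fun u _ => ?_
  rw [← Finset.sum_neg_distrib]
  refine Finset.sum_congr rfl fun v _ => ?_
  rcases lt_trichotomy u v with h | h | h
  · rw [if_neg h.ne, if_neg h.ne', if_neg h.not_gt, if_pos h, Finset.erase_right_comm]
    ring
  · simp [h]
  · rw [if_neg h.ne, if_neg h.ne', if_pos h, if_neg h.not_gt, Finset.erase_right_comm]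
    ring

theorem wedge_wedge_self (a : V → ℝ) (φ : Finset V → ℝ) : wedge a (wedge a φ) = 0 :=
  self_eq_neg.mp (wedge_wedge_comm a a φ)

variable [Fintype V]

/-- The contraction of a form `φ` with a `1`-form `a`, the adjoint of `wedge a`. -/
def contract (a : V → ℝ) (φ : Finset V → ℝ) : Finset V → ℝ :=
  fun G => ∑ v ∈ Gᶜ, vertexSign v G * a v * φ (insert v G)

theorem contract_smul_right (a : V → ℝ) (r : ℝ) (φ : Finset V → ℝ) :
    contract a (r • φ) = r • contract a φ := by
  funext F
  simp only [contract, Pi.smul_apply, smul_eq_mul, Finset.mul_sum]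
  exact Finset.sum_congr rfl fun v _ => by ring

theorem sum_wedge_mul (a : V → ℝ) (φ ψ : Finset V → ℝ) :
    ∑ F, wedge a φ F * ψ F = ∑ G, φ G * contract a ψ G := by
  simp only [wedge, contract, Finset.sum_mul, Finset.mul_sum]
  rw [Finset.sum_sigma', Finset.sum_sigma']
  refine Finset.sum_bij' (fun p _ => ⟨p.1.erase p.2, p.2⟩) (fun p _ => ⟨insert p.2 p.1, p.2⟩)
    ?_ ?_ ?_ ?_ ?_
  · rintro ⟨F, v⟩ _
    simp
  · rintro ⟨G, v⟩ _
    simp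
  · rintro ⟨F, v⟩ h
    simp only [Finset.mem_sigma, Finset.mem_univ, true_and] at h
    simp [Finset.insert_erase h]
  · rintro ⟨G, v⟩ h
    simp only [Finset.mem_sigma, Finset.mem_univ, true_and, Finset.mem_compl] at h
    simp [Finset.erase_insert h]
  · rintro ⟨F, v⟩ h
    simp only [Finset.mem_sigma, Finset.mem_univ, true_and] at h
    simp only [Finset.insert_erase h, vertexSign_erase h, lt_irrefl, if_false, one_mul]
    ring

/-- Cartan's formula (the Clifford relation). For `a = 1` it says that the Laplacian of the full
simplex on `V` is multiplication by the number of vertices. -/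
theorem contract_wedge_add_wedge_contract (a : V → ℝ) (φ : Finset V → ℝ) :
    contract a (wedge a φ) + wedge a (contract a φ) = (∑ v, a v ^ 2) • φ := by
  funext G
  have h1 : contract a (wedge a φ) G = ∑ v ∈ Gᶜ, a v ^ 2 * φ G +
      ∑ v ∈ Gᶜ, ∑ u ∈ G, vertexSign v G * a v *
        ((if v < u then -1 else 1) * vertexSign u G * a u * φ ((insert v G).erase u)) := by
    rw [contract, ← Finset.sum_add_distrib]
    refine Finset.sum_congr rfl fun v hv => ?_
    have hv' := Finset.mem_compl.mp hv
    rw [wedge, Finset.sum_insert hv', mul_add, Finset.mul_sum, Finset.erase_insert hv',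
      vertexSign_insert hv', if_neg (lt_irrefl v)]
    congr 1
    · linear_combination a v ^ 2 * φ G * vertexSign_mul_self v G
    · refine Finset.sum_congr rfl fun u hu => ?_
      rw [vertexSign_insert hv']
  have h2 : wedge a (contract a φ) G = ∑ v ∈ G, a v ^ 2 * φ G +
      ∑ u ∈ G, ∑ v ∈ Gᶜ, vertexSign u G * a u *
        ((if u < v then -1 else 1) * vertexSign v G * a v * φ ((insert v G).erase u)) := by
    rw [wedge, ← Finset.sum_add_distrib]
    refine Finset.sum_congr rfl fun u hu => ?_
    have hc : (G.erase u)ᶜ = insert u Gᶜ := by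
      ext x
      simp only [Finset.mem_compl, Finset.mem_erase, Finset.mem_insert]
      tauto
    rw [contract, hc, Finset.sum_insert (by simpa using hu), mul_add, Finset.mul_sum,
      Finset.insert_erase hu, vertexSign_erase hu, if_neg (lt_irrefl u)]
    congr 1
    · linear_combination a u ^ 2 * φ G * vertexSign_mul_self u G
    · refine Finset.sum_congr rfl fun v hv => ?_
      have hvu : v ≠ u := by
        rintro rfl
        exact Finset.mem_compl.mp hv hu
      rw [vertexSign_erase hu, Finset.erase_insert_of_ne hvu]
  rw [Pi.add_apply, h1, h2, Finset.sum_comm (s := G)]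
  have h3 : ∀ v ∈ Gᶜ, ∀ u ∈ G, vertexSign u G * a u *
        ((if u < v then -1 else 1) * vertexSign v G * a v * φ ((insert v G).erase u)) =
      -(vertexSign v G * a v *
        ((if v < u then -1 else 1) * vertexSign u G * a u * φ ((insert v G).erase u))) := by
    intro v hv u hu
    have hvu : v ≠ u := by
      rintro rfl
      exact Finset.mem_compl.mp hv hu
    rcases lt_or_gt_of_ne hvu with h | h
    · rw [if_neg h.not_gt, if_pos h]; ring
    · rw [if_pos h, if_neg h.not_gt]; ring
  rw [Finset.sum_congr rfl fun v hv => Finset.sum_congr rfl (h3 v hv)]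
  simp only [Finset.sum_neg_distrib]
  rw [Pi.smul_apply, smul_eq_mul, Finset.sum_mul, ← Finset.sum_add_sum_compl G]
  ring

theorem contract_contract_self (a : V → ℝ) (φ : Finset V → ℝ) : contract a (contract a φ) = 0 := by
  have h := sum_wedge_mul a (wedge a (contract a (contract a φ))) φ
  rw [wedge_wedge_self, sum_wedge_mul] at h
  simp only [Pi.zero_apply, zero_mul, Finset.sum_const_zero] at h
  funext G
  have := (Finset.sum_eq_zero_iff_of_nonneg fun G _ => mul_self_nonneg _).mp h.symm G
    (Finset.mem_univ G)
  simpa using this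

theorem sum_wedge_sq (a : V → ℝ) {φ : Finset V → ℝ} (h : contract a φ = 0) :
    ∑ F, wedge a φ F ^ 2 = (∑ v, a v ^ 2) * ∑ F, φ F ^ 2 := by
  have h1 := contract_wedge_add_wedge_contract a φ
  have h0 : wedge a (0 : Finset V → ℝ) = 0 := by funext F; simp [wedge]
  rw [h, h0, add_zero] at h1
  simp only [sq (wedge a φ _)]
  rw [sum_wedge_mul, h1, Finset.mul_sum]
  exact Finset.sum_congr rfl fun F _ => by simp; ring

end Wedge

/-! ### Spectral bounds for symmetric operators -/

/-- A symmetric operator with spectrum in `[k - ε, k + ε]` differs from `k` by an operator of norm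
at most `ε`. The inner product is an explicit form `B`, so that the bound applies to function
spaces carrying another norm. -/
theorem abs_bilin_sub_le {W : Type*} [AddCommGroup W] [Module ℝ W] [FiniteDimensional ℝ W]
    (B : W →ₗ[ℝ] W →ₗ[ℝ] ℝ) (hsymm : ∀ x y, B x y = B y x) (hpos : ∀ x, x ≠ 0 → 0 < B x x)
    (T : Module.End ℝ W) (hT : ∀ x y, B (T x) y = B x (T y)) {k ε : ℝ}
    (hspec : spectrum ℝ T ⊆ Set.Icc (k - ε) (k + ε)) (x y : W) :
    |B x (T y) - k * B x y| ≤ ε * (√(B x x) * √(B y y)) := by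
  let core : InnerProductSpace.Core ℝ W :=
    { inner := fun x y => B x y
      conj_inner_symm := fun x y => by simpa using hsymm y x
      re_inner_nonneg := fun x => by
        rcases eq_or_ne x 0 with rfl | h
        · simp
        · simpa using (hpos x h).le
      add_left := fun x y z => by simp
      smul_left := fun x y r => by simp
      definite := fun x hx => by
        by_contra h
        exact (hpos x h).ne' hx }
  let _ : NormedAddCommGroup W := core.toNormedAddCommGroup
  let _ : InnerProductSpace ℝ W := InnerProductSpace.ofCore core.toCore
  have hB : ∀ x y : W, B x y = inner ℝ x y := fun _ _ => rfl
  have hn : ∀ x : W, √(B x x) = ‖x‖ := fun x => by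
    rw [hB, real_inner_self_eq_norm_sq, Real.sqrt_sq (norm_nonneg x)]
  have hTs : T.IsSymmetric := fun x y => hT x y
  let b := hTs.eigenvectorBasis rfl
  have hev : ∀ i, |hTs.eigenvalues rfl i - k| ≤ ε := fun i => by
    have h1 : hTs.eigenvalues rfl i ∈ Set.Icc (k - ε) (k + ε) :=
      hspec ((hTs.hasEigenvalue_eigenvalues rfl i).mem_spectrum)
    rw [abs_le]
    constructor <;> linarith [h1.1, h1.2]
  have key : ‖T y - k • y‖ ≤ ε * ‖y‖ := by
    rcases isEmpty_or_nonempty (Fin (Module.finrank ℝ W)) with he | ⟨⟨i₀⟩⟩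
    · have : Subsingleton W := by
        rw [← Module.finrank_zero_iff (R := ℝ)]
        by_contra h
        exact he.false ⟨0, Nat.pos_of_ne_zero h⟩
      simp [Subsingleton.elim y 0]
    have hε : 0 ≤ ε := (abs_nonneg _).trans (hev i₀)
    rw [← sq_le_sq₀ (norm_nonneg _) (by positivity), mul_pow, ← b.sum_sq_norm_inner_right y,
      ← b.sum_sq_norm_inner_right, Finset.mul_sum]
    refine Finset.sum_le_sum fun i _ => ?_
    have h2 : inner ℝ (b i) (T y - k • y) = (hTs.eigenvalues rfl i - k) * inner ℝ (b i) y := by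
      rw [inner_sub_right, ← hTs (b i) y, hTs.apply_eigenvectorBasis rfl i]
      simp only [RCLike.ofReal_real_eq_id, id_eq, inner_smul_left, inner_smul_right, conj_trivial]
      ring
    rw [h2, norm_mul, mul_pow]
    gcongr
    exact hev i
  rw [hn, hn]
  have : B x (T y) - k * B x y = inner ℝ x (T y - k • y) := by
    rw [inner_sub_right, inner_smul_right, hB, hB]
  rw [this]
  calc _ ≤ ‖x‖ * ‖T y - k • y‖ := abs_real_inner_le_norm _ _
    _ ≤ ‖x‖ * (ε * ‖y‖) := by gcongr
    _ = _ := by ring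

/-! ### The mixing inequality -/

section Chains

variable {V : Type*} [Fintype V]

theorem sum_cells_of_support (X : AbstractSimplicialComplex V) {i : ℤ} (g : Finset V → ℝ)
    (hg : ∀ F, F ∉ X.cells i → g F = 0) :
    ∑ F : {s : Finset V // s ∈ X.cells i}, g F.1 = ∑ F, g F := by
  rw [Finset.sum_coe_sort (X.cells i) g]
  exact Finset.sum_subset (Finset.subset_univ _) fun F _ hF => hg F hF

/-- The restriction of a form to the `i`-cells of a complex. -/
def toChain (X : AbstractSimplicialComplex V) (i : ℤ) (g : Finset V → ℝ) : X.Chain i :=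
  fun F => g F.1

/-- The standard inner product of chains. -/
noncomputable def chainForm (X : AbstractSimplicialComplex V) (i : ℤ) :
    X.Chain i →ₗ[ℝ] X.Chain i →ₗ[ℝ] ℝ :=
  dotProductBilin ℝ ℝ

theorem chainForm_apply (X : AbstractSimplicialComplex V) {i : ℤ} (f g : X.Chain i) :
    X.chainForm i f g = ∑ F, f F * g F := rfl

theorem chainForm_comm (X : AbstractSimplicialComplex V) {i : ℤ} (f g : X.Chain i) :
    X.chainForm i f g = X.chainForm i g f :=
  dotProduct_comm f g

end Chains

section Mixing

variable {V : Type*} [LinearOrder V]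

theorem wedge_eq_zero_of_card {m : ℕ} {φ : Finset V → ℝ} (hφ : ∀ G, G.card ≠ m → φ G = 0)
    (a : V → ℝ) {F : Finset V} (hF : F.card ≠ m + 1) : wedge a φ F = 0 := by
  refine Finset.sum_eq_zero fun v hv => ?_
  rw [hφ, mul_zero]
  have := Finset.card_erase_add_one hv
  omega

theorem contract_eq_zero_of_card [Fintype V] {m : ℕ} {φ : Finset V → ℝ}
    (hφ : ∀ G, G.card ≠ m + 1 → φ G = 0) (a : V → ℝ) {F : Finset V} (hF : F.card ≠ m) :
    contract a φ F = 0 := by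
  refine Finset.sum_eq_zero fun v hv => ?_
  rw [hφ, mul_zero]
  have := Finset.card_insert_of_notMem (Finset.mem_compl.mp hv)
  omega

theorem incidence_eq_wedge (F G : Finset V) :
    incidence F G = wedge 1 (Pi.single G 1) F := by
  refine Finset.sum_congr rfl fun v _ => ?_
  by_cases h : F.erase v = G
  · simp [h, vertexSign]
  · simp [h]

variable [Fintype V]

theorem sum_incidence_mul_right (F : Finset V) (g : Finset V → ℝ) :
    ∑ G, incidence F G * g G = wedge 1 g F := by
  simp only [incidence, Finset.sum_mul, wedge]
  rw [Finset.sum_comm]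
  refine Finset.sum_congr rfl fun v _ => ?_
  simp [vertexSign]

theorem sum_incidence_mul_left (G : Finset V) (g : Finset V → ℝ) :
    ∑ F, incidence F G * g F = contract 1 g G := by
  simp only [incidence_eq_wedge]
  rw [sum_wedge_mul]
  simp [Pi.single_apply]

theorem coboundary_toChain (X : AbstractSimplicialComplex V) {i : ℤ} (j : ℤ) {g : Finset V → ℝ}
    (hg : ∀ F, F ∉ X.cells i → g F = 0) :
    X.coboundary i j (X.toChain i g) = X.toChain j (wedge 1 g) := by
  funext F
  rw [toChain, ← sum_incidence_mul_right]
  exact X.sum_cells_of_support (fun G => incidence F.1 G * g G) fun G hG => by simp [hg G hG]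

theorem boundary_toChain (X : AbstractSimplicialComplex V) {i : ℤ} (j : ℤ) {g : Finset V → ℝ}
    (hg : ∀ F, F ∉ X.cells i → g F = 0) :
    X.boundary i j (X.toChain i g) = X.toChain j (contract 1 g) := by
  funext G
  rw [toChain, ← sum_incidence_mul_left]
  exact X.sum_cells_of_support (fun F => incidence F G.1 * g F) fun F hF => by simp [hg F hF]

theorem chainForm_boundary (X : AbstractSimplicialComplex V) {i j : ℤ} (f : X.Chain i)
    (g : X.Chain j) : X.chainForm j (X.boundary i j f) g = X.chainForm i f (X.coboundary j i g) := by
  simp only [chainForm_apply, boundary, coboundary, LinearMap.coe_mk, AddHom.coe_mk,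
    Finset.sum_mul, Finset.mul_sum]
  rw [Finset.sum_comm]
  exact Finset.sum_congr rfl fun _ _ => Finset.sum_congr rfl fun _ _ => by ring

theorem chainForm_laplacian (X : AbstractSimplicialComplex V) {i : ℤ} (f g : X.Chain i) :
    X.chainForm i f (X.laplacian i g) =
      X.chainForm (i + 1) (X.coboundary i (i + 1) f) (X.coboundary i (i + 1) g) +
      X.chainForm (i - 1) (X.boundary i (i - 1) f) (X.boundary i (i - 1) g) := by
  simp only [laplacian, LinearMap.add_apply, LinearMap.comp_apply, map_add]
  rw [← chainForm_boundary X f, X.chainForm_comm f, chainForm_boundary,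
    X.chainForm_comm (X.coboundary i (i + 1) g)]

/-- For cycles `f` and `g`, the spectral hypothesis bounds `⟨δf, δg⟩ - k ⟨f, g⟩`. -/
theorem abs_coboundary_sub_le (X : AbstractSimplicialComplex V) {i : ℤ} {k ε : ℝ}
    (hspec : X.cycleSpectrum i ⊆ Set.Icc (k - ε) (k + ε)) {f g : X.Chain i}
    (hf : f ∈ X.cycles i) (hg : g ∈ X.cycles i) :
    |X.chainForm (i + 1) (X.coboundary i (i + 1) f) (X.coboundary i (i + 1) g)
        - k * X.chainForm i f g| ≤
      ε * (√(X.chainForm i f f) * √(X.chainForm i g g)) := by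
  have h := abs_bilin_sub_le ((X.chainForm i).domRestrict₁₂ (X.cycles i) (X.cycles i))
    (fun x y => X.chainForm_comm x.1 y.1)
    (fun x hx => by
      have h0 : 0 ≤ X.chainForm i x.1 x.1 := Finset.sum_nonneg fun _ _ => mul_self_nonneg _
      refine lt_of_le_of_ne h0 fun h => hx (Subtype.ext ?_)
      exact dotProduct_self_eq_zero.mp h.symm)
    (X.laplacianOnCycles i)
    (fun x y => by
      change X.chainForm i (X.laplacian i x.1) y.1 = X.chainForm i x.1 (X.laplacian i y.1)
      rw [X.chainForm_comm, chainForm_laplacian, chainForm_laplacian, X.chainForm_comm,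
        X.chainForm_comm (X.boundary i (i - 1) y.1)])
    hspec ⟨f, hf⟩ ⟨g, hg⟩
  change |X.chainForm i f (X.laplacian i g) - k * X.chainForm i f g| ≤
    ε * (√(X.chainForm i f f) * √(X.chainForm i g g)) at h
  rwa [chainForm_laplacian, show X.boundary i (i - 1) f = 0 from hf, map_zero,
    LinearMap.zero_apply, add_zero] at h

/-- If the `(d - 1)`-skeleton is complete, then the projection of a form `φ` of degree `d` to the
cycles is `n⁻¹ ∂δφ`, with `∂` and `δ` those of the full simplex. It has the same coboundary as
`φ`, so the spectral hypothesis compares the sum of `δφ δψ` over the `d`-cells of `X` with the sum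
over all sets of `d + 1` vertices. -/
theorem abs_sum_cells_wedge_sub_le [Nonempty V] {d : ℕ} (X : AbstractSimplicialComplex V)
    (hskel : X.HasCompleteSkeleton ((d : ℤ) - 1)) {k ε : ℝ}
    (hspec : X.cycleSpectrum ((d : ℤ) - 1) ⊆ Set.Icc (k - ε) (k + ε)) {φ ψ : Finset V → ℝ}
    (hφ : ∀ G, G.card ≠ d → φ G = 0) (hψ : ∀ G, G.card ≠ d → ψ G = 0) :
    |∑ F ∈ X.cells d, wedge 1 φ F * wedge 1 ψ F
        - k / Fintype.card V * ∑ F, wedge 1 φ F * wedge 1 ψ F| ≤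
      ε / Fintype.card V * (√(∑ F, wedge 1 φ F ^ 2) * √(∑ F, wedge 1 ψ F ^ 2)) := by
  set n : ℝ := (Fintype.card V : ℝ) with hn
  have hn0 : 0 < n := by rw [hn]; exact_mod_cast Fintype.card_pos
  let proj : (Finset V → ℝ) → Finset V → ℝ := fun φ => n⁻¹ • contract 1 (wedge 1 φ)
  have hcells : ∀ F : Finset V, F ∉ X.cells ((d : ℤ) - 1) → F.card ≠ d := by
    intro F hF h
    have h' : (F.card : ℤ) = (d : ℤ) - 1 + 1 := by omega
    exact hF (mem_cells.mpr ⟨hskel F h', h'⟩)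
  have hsupp : ∀ φ : Finset V → ℝ, (∀ G, G.card ≠ d → φ G = 0) →
      ∀ F, F ∉ X.cells ((d : ℤ) - 1) → proj φ F = 0 := by
    intro φ hφ F hF
    simp only [proj, Pi.smul_apply]
    rw [contract_eq_zero_of_card (fun G hG => wedge_eq_zero_of_card hφ 1 hG) 1 (hcells F hF),
      smul_zero]
  have hcyc : ∀ φ : Finset V → ℝ, (∀ G, G.card ≠ d → φ G = 0) →
      X.toChain _ (proj φ) ∈ X.cycles ((d : ℤ) - 1) := by
    intro φ hφ
    change X.boundary _ _ _ = 0
    rw [boundary_toChain X _ (hsupp φ hφ), contract_smul_right, contract_contract_self, smul_zero]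
    rfl
  have hwedge : ∀ φ : Finset V → ℝ, wedge 1 (contract 1 (wedge 1 φ)) = n • wedge 1 φ := by
    intro φ
    have h := contract_wedge_add_wedge_contract 1 (wedge 1 φ)
    have h0 : contract 1 (0 : Finset V → ℝ) = 0 := by funext F; simp [contract]
    rw [wedge_wedge_self, h0, zero_add] at h
    rw [h]
    simp [hn]
  have hcob : ∀ φ : Finset V → ℝ, wedge 1 (proj φ) = wedge 1 φ := by
    intro φ
    rw [wedge_smul_right, hwedge, smul_smul, inv_mul_cancel₀ hn0.ne', one_smul]
  have hform : ∀ φ ψ : Finset V → ℝ, (∀ G, G.card ≠ d → φ G = 0) →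
      X.chainForm ((d : ℤ) - 1) (X.toChain _ (proj φ)) (X.toChain _ (proj ψ)) =
        n⁻¹ * ∑ F, wedge 1 φ F * wedge 1 ψ F := by
    intro φ ψ hφ
    have h1 := X.sum_cells_of_support (i := (d : ℤ) - 1) (fun F => proj φ F * proj ψ F)
      fun F hF => by simp [hsupp φ hφ F hF]
    rw [chainForm_apply]
    refine h1.trans ?_
    have h2 := sum_wedge_mul 1 (proj φ) (wedge 1 ψ)
    rw [hcob] at h2
    rw [h2, Finset.mul_sum]
    exact Finset.sum_congr rfl fun F _ => by simp only [proj, Pi.smul_apply, smul_eq_mul]; ring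
  have h := X.abs_coboundary_sub_le hspec (hcyc φ hφ) (hcyc ψ hψ)
  rw [coboundary_toChain X _ (hsupp φ hφ), coboundary_toChain X _ (hsupp ψ hψ), hcob, hcob,
    hform φ ψ hφ, hform φ φ hφ, hform ψ ψ hψ] at h
  have h3 : X.chainForm ((d : ℤ) - 1 + 1) (X.toChain _ (wedge 1 φ)) (X.toChain _ (wedge 1 ψ)) =
      ∑ F ∈ X.cells d, wedge 1 φ F * wedge 1 ψ F := by
    rw [chainForm_apply]
    have := Finset.sum_coe_sort (X.cells ((d : ℤ) - 1 + 1)) fun F => wedge 1 φ F * wedge 1 ψ F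
    rw [sub_add_cancel] at this ⊢
    exact this
  rw [h3] at h
  simp only [sq]
  rw [Real.sqrt_mul (by positivity), Real.sqrt_mul (by positivity)] at h
  have h4 : √n⁻¹ * √n⁻¹ = n⁻¹ := Real.mul_self_sqrt (by positivity)
  calc _ = _ := by congr 1; ring
    _ ≤ _ := h
    _ = ε * (√n⁻¹ * √n⁻¹) * (√(∑ F, wedge 1 φ F * wedge 1 φ F) *
          √(∑ F, wedge 1 ψ F * wedge 1 ψ F)) := by ring
    _ = _ := by rw [h4]; ring

end Mixing

/-! ### Degrees -/

section Degree

variable {V : Type*} [LinearOrder V]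

theorem wedge_single_sq (F G : Finset V) :
    wedge 1 (Pi.single G 1) F ^ 2 = if G ⊆ F ∧ F.card = G.card + 1 then (1 : ℝ) else 0 := by
  by_cases h : ∃ v ∈ F, F.erase v = G
  · obtain ⟨v, hv, rfl⟩ := h
    have h1 : wedge 1 (Pi.single (F.erase v) 1) F = vertexSign v F := by
      rw [wedge, Finset.sum_eq_single_of_mem v hv]
      · simp
      · intro u hu huv
        rw [Pi.single_eq_of_ne, mul_zero]
        exact fun h => huv (Finset.erase_injOn F hu hv h)
    rw [h1, sq, vertexSign_mul_self,
      if_pos ⟨Finset.erase_subset v F, (Finset.card_erase_add_one hv).symm⟩]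
  · rw [if_neg, wedge, Finset.sum_eq_zero, zero_pow two_ne_zero]
    · intro v hv
      rw [Pi.single_eq_of_ne fun h' => h ⟨v, hv, h'⟩, mul_zero]
    · rintro ⟨hs, hc⟩
      obtain ⟨v, hv⟩ := Finset.card_eq_one.mp
        (show (F \ G).card = 1 by rw [Finset.card_sdiff_of_subset hs]; omega)
      have hv' : v ∈ F \ G := hv ▸ Finset.mem_singleton_self v
      refine h ⟨v, (Finset.mem_sdiff.mp hv').1, ?_⟩
      rw [← Finset.sdiff_singleton_eq_erase, ← hv, Finset.sdiff_sdiff_eq_self hs]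

variable [Fintype V]

theorem sum_wedge_single_sq (G : Finset V) :
    ∑ F, wedge 1 (Pi.single G 1) F ^ 2 = (Fintype.card V : ℝ) - G.card := by
  simp only [wedge_single_sq]
  rw [Finset.sum_boole]
  have h : (Finset.univ.filter fun F : Finset V => G ⊆ F ∧ F.card = G.card + 1) =
      Gᶜ.image (insert · G) := by
    ext F
    simp only [Finset.mem_filter, Finset.mem_univ, true_and, Finset.mem_image, Finset.mem_compl]
    constructor
    · rintro ⟨hs, hc⟩
      exact (Finset.exists_eq_insert_iff.mpr ⟨hs, hc.symm⟩)
    · rintro ⟨v, hv, rfl⟩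
      exact ⟨Finset.subset_insert v G, Finset.card_insert_of_notMem hv⟩
  rw [h, Finset.card_image_of_injOn, Finset.card_compl, Nat.cast_sub (Finset.card_le_univ G)]
  intro u hu v hv huv
  have h1 : u ∈ insert v G := by
    rw [← show insert u G = insert v G from huv]
    exact Finset.mem_insert_self u G
  exact (Finset.mem_insert.mp h1).resolve_right (by simpa using hu)

theorem sum_cells_wedge_single_sq (X : AbstractSimplicialComplex V) {d : ℕ} {G : Finset V}
    (hG : G.card = d) :
    ∑ F ∈ X.cells d, wedge 1 (Pi.single G 1) F ^ 2 = (X.degree ((d : ℤ) - 1) G : ℝ) := by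
  simp only [wedge_single_sq]
  rw [Finset.sum_boole, degree, sub_add_cancel]
  congr 2
  ext F
  simp only [Finset.mem_filter]
  refine and_congr_right fun hF => and_iff_left ?_
  have := (mem_cells.mp hF).2
  omega

end Degree

section Count

variable {V : Type*} [Fintype V]

theorem cells_eq_powersetCard (X : AbstractSimplicialComplex V) {d : ℕ}
    (hskel : X.HasCompleteSkeleton ((d : ℤ) - 1)) :
    X.cells ((d : ℤ) - 1) = Finset.powersetCard d Finset.univ := by
  ext F
  rw [mem_cells, Finset.mem_powersetCard, sub_add_cancel]
  constructor
  · rintro ⟨-, h⟩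
    exact ⟨Finset.subset_univ F, by exact_mod_cast h⟩
  · rintro ⟨-, h⟩
    have h' : (F.card : ℤ) = (d : ℤ) - 1 + 1 := by omega
    exact ⟨hskel F h', by omega⟩

theorem sum_degree (X : AbstractSimplicialComplex V) (d : ℕ) :
    ∑ s ∈ X.cells ((d : ℤ) - 1), X.degree ((d : ℤ) - 1) s = (d + 1) * (X.cells d).card := by
  classical
  have h := Finset.sum_card_bipartiteAbove_eq_sum_card_bipartiteBelow
    (s := X.cells ((d : ℤ) - 1)) (t := X.cells d) (fun s t => s ⊆ t)
  have h1 : ∀ t ∈ X.cells d,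
      ((X.cells ((d : ℤ) - 1)).bipartiteBelow (fun s t => s ⊆ t) t).card = d + 1 := by
    intro t ht
    obtain ⟨htf, htc⟩ := mem_cells.mp ht
    have hc : t.card = d + 1 := by omega
    have : (X.cells ((d : ℤ) - 1)).bipartiteBelow (fun s t => s ⊆ t) t = t.powersetCard d := by
      ext s
      rw [Finset.mem_bipartiteBelow, Finset.mem_powersetCard, mem_cells]
      constructor
      · rintro ⟨⟨-, h1⟩, h2⟩
        exact ⟨h2, by omega⟩
      · rintro ⟨h1, h2⟩
        exact ⟨⟨htf.mono h1, by omega⟩, h1⟩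
    rw [this, Finset.card_powersetCard, hc, Nat.choose_succ_self_right]
  rw [Finset.sum_congr rfl h1, Finset.sum_const, smul_eq_mul, mul_comm] at h
  rw [← h]
  refine Finset.sum_congr rfl fun s _ => ?_
  rw [degree, sub_add_cancel, Finset.bipartiteAbove]

theorem card_cells_mul (X : AbstractSimplicialComplex V) {d : ℕ} (hn : d ≤ Fintype.card V)
    (hskel : X.HasCompleteSkeleton ((d : ℤ) - 1)) :
    ((d : ℝ) + 1) * (X.cells d).card =
      X.averageDegree ((d : ℤ) - 1) * (Fintype.card V).choose d := by
  have h := X.sum_degree d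
  have h0 : ((Fintype.card V).choose d : ℝ) ≠ 0 := by
    exact_mod_cast (Nat.choose_pos hn).ne'
  rw [averageDegree, ← Nat.cast_sum, h, cells_eq_powersetCard X hskel, Finset.card_powersetCard,
    Finset.card_univ, div_mul_cancel₀ _ h0]
  push_cast
  rfl

end Count

/-- The mixing inequality for single cells, averaged over all of them. The trace of `∂δ` is
`k` times the number of `(d - 1)`-cells, but `∂δ` vanishes on the complement of the cycles, so its
eigenvalues on the cycles exceed `k` on the average. -/
theorem averageDegree_mul_le {V : Type*} [LinearOrder V] [Fintype V] {d : ℕ}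
    (X : AbstractSimplicialComplex V) (hn : d < Fintype.card V)
    (hskel : X.HasCompleteSkeleton ((d : ℤ) - 1)) {k ε : ℝ}
    (hk : k = X.averageDegree ((d : ℤ) - 1))
    (hspec : X.cycleSpectrum ((d : ℤ) - 1) ⊆ Set.Icc (k - ε) (k + ε)) :
    k * d ≤ ε * (Fintype.card V - d) := by
  have hne : Nonempty V := Fintype.card_pos_iff.mp (by omega)
  have hn0 : (0 : ℝ) < Fintype.card V := by exact_mod_cast Fintype.card_pos
  have hnd : (d : ℝ) < Fintype.card V := by exact_mod_cast hn
  have hsingle : ∀ s ∈ X.cells ((d : ℤ) - 1), (X.degree ((d : ℤ) - 1) s : ℝ) ≤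
      (k + ε) / Fintype.card V * (Fintype.card V - d) := by
    intro s hs
    have hsc : s.card = d := by
      have := (mem_cells.mp hs).2
      omega
    have hsupp : ∀ G : Finset V, G.card ≠ d → (Pi.single s 1 : Finset V → ℝ) G = 0 :=
      fun G hG => Pi.single_eq_of_ne (by rintro rfl; exact hG hsc) _
    have h := (le_abs_self _).trans (X.abs_sum_cells_wedge_sub_le hskel hspec hsupp hsupp)
    simp only [← sq] at h
    rw [sum_cells_wedge_single_sq X hsc, sum_wedge_single_sq, hsc,
      Real.sq_sqrt (by linarith)] at h
    rw [add_div, add_mul]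
    linarith
  have hsum := Finset.sum_le_sum hsingle
  have hcard : (0 : ℝ) < (X.cells ((d : ℤ) - 1)).card := by
    rw [cells_eq_powersetCard X hskel, Finset.card_powersetCard, Finset.card_univ]
    exact_mod_cast Nat.choose_pos hn.le
  have hk' : k ≤ (k + ε) / Fintype.card V * (Fintype.card V - d) := by
    rw [Finset.sum_const, nsmul_eq_mul] at hsum
    conv_lhs => rw [hk, averageDegree]
    rw [div_le_iff₀ hcard]
    linarith
  rw [div_mul_eq_mul_div, le_div_iff₀ hn0] at hk'
  linarith

/-! ### Product forms and transversals -/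

section Transversal

variable {V : Type*} [DecidableEq V]

/-- The elements of `F` can be matched with the sets of the list so that each lies in its set. For
pairwise disjoint sets, `F` consists of one element of each of them. -/
def IsTransversal : List (Finset V) → Finset V → Prop
  | [], F => F = ∅
  | A :: L, F => ∃ v ∈ F, v ∈ A ∧ IsTransversal L (F.erase v)

theorem IsTransversal.exists_mem {L : List (Finset V)} {F : Finset V} (h : IsTransversal L F)
    {v : V} (hv : v ∈ F) : ∃ A ∈ L, v ∈ A := by
  induction L generalizing F with
  | nil => simp [show F = ∅ from h] at hv
  | cons B L ih =>
    obtain ⟨u, -, huB, hT⟩ := h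
    by_cases huv : v = u
    · exact ⟨B, by simp, huv ▸ huB⟩
    · obtain ⟨A, hA, hvA⟩ := ih hT (Finset.mem_erase.mpr ⟨huv, hv⟩)
      exact ⟨A, by simp [hA], hvA⟩

theorem IsTransversal.exists_mem_of_mem {L : List (Finset V)} {F : Finset V}
    (h : IsTransversal L F) {A : Finset V} (hA : A ∈ L) : ∃ v ∈ F, v ∈ A := by
  induction L generalizing F with
  | nil => simp at hA
  | cons B L ih =>
    obtain ⟨u, hu, huB, hT⟩ := h
    rcases List.mem_cons.mp hA with rfl | hA
    · exact ⟨u, hu, huB⟩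
    · obtain ⟨v, hv, hvA⟩ := ih hT hA
      exact ⟨v, Finset.mem_of_mem_erase hv, hvA⟩

theorem IsTransversal.exists_eq_image {m : ℕ} {Q : Fin m → Finset V} {F : Finset V}
    (h : IsTransversal (List.ofFn Q) F) :
    ∃ x : Fin m → V, (∀ i, x i ∈ Q i) ∧ F = Finset.univ.image x := by
  induction m generalizing F with
  | zero =>
    rw [List.ofFn_zero] at h
    exact ⟨Fin.elim0, fun i => i.elim0, by simpa using show F = ∅ from h⟩
  | succ m ih =>
    rw [List.ofFn_succ] at h
    obtain ⟨v, hv, hvQ, hT⟩ := h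
    obtain ⟨x, hx, hF⟩ := ih hT
    refine ⟨Fin.cons v x, fun i => Fin.cases hvQ hx i, ?_⟩
    rw [← Finset.insert_erase hv, hF]
    ext u
    simp [Fin.exists_fin_succ, eq_comm]

end Transversal

section ProductForm

variable {V : Type*} [LinearOrder V]

/-- The indicator function of a set of vertices, as a `1`-form. -/
def vertexForm (A : Finset V) : V → ℝ := fun v => if v ∈ A then 1 else 0

/-- The wedge product of the indicator functions of the sets of the list. -/
def productForm : List (Finset V) → Finset V → ℝ
  | [] => Pi.single ∅ 1
  | A :: L => wedge (vertexForm A) (productForm L)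

theorem isTransversal_of_productForm_ne_zero {L : List (Finset V)} {F : Finset V}
    (h : productForm L F ≠ 0) : IsTransversal L F := by
  induction L generalizing F with
  | nil =>
    by_contra hF
    exact h (Pi.single_eq_of_ne hF _)
  | cons A L ih =>
    obtain ⟨v, hv, hne⟩ := Finset.exists_ne_zero_of_sum_ne_zero h
    refine ⟨v, hv, ?_, ih (right_ne_zero_of_mul hne)⟩
    by_contra hvA
    simp [vertexForm, hvA] at hne

theorem productForm_sq_of_isTransversal {L : List (Finset V)} (hL : L.Pairwise Disjoint)
    {F : Finset V} (h : IsTransversal L F) : productForm L F ^ 2 = 1 := by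
  induction L generalizing F with
  | nil => simp [productForm, show F = ∅ from h]
  | cons A L ih =>
    obtain ⟨hA, hL⟩ := List.pairwise_cons.mp hL
    obtain ⟨v, hv, hvA, hT⟩ := h
    have h1 : productForm (A :: L) F = vertexSign v F * productForm L (F.erase v) := by
      rw [productForm, wedge, Finset.sum_eq_single_of_mem v hv]
      · simp [vertexForm, hvA]
      · intro u hu huv
        obtain ⟨B, hB, huB⟩ := hT.exists_mem (Finset.mem_erase.mpr ⟨huv, hu⟩)
        simp [vertexForm, Finset.disjoint_right.mp (hA B hB) huB]
    rw [h1, mul_pow, ih hL hT, sq, vertexSign_mul_self, one_mul]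

theorem wedge_zero_right (a : V → ℝ) : wedge a 0 = 0 := by
  funext F
  simp [wedge]

theorem wedge_vertexForm_productForm {L : List (Finset V)} {A : Finset V} (hA : A ∈ L) :
    wedge (vertexForm A) (productForm L) = 0 := by
  induction L with
  | nil => simp at hA
  | cons B L ih =>
    rcases List.mem_cons.mp hA with rfl | hA
    · exact wedge_wedge_self _ _
    · rw [productForm, wedge_wedge_comm, ih hA, wedge_zero_right, neg_zero]

theorem productForm_eq_zero_of_card {L : List (Finset V)} {F : Finset V}
    (hF : F.card ≠ L.length) : productForm L F = 0 := by
  induction L generalizing F with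
  | nil =>
    refine Pi.single_eq_of_ne ?_ _
    rintro rfl
    simp at hF
  | cons A L ih => exact wedge_eq_zero_of_card (fun G hG => ih hG) _ hF

variable [Fintype V]

theorem sum_vertexForm_sq (A : Finset V) : ∑ v, vertexForm A v ^ 2 = A.card := by
  simp [vertexForm]

theorem sum_productForm_sq {L : List (Finset V)} (hL : L.Pairwise Disjoint) :
    ∑ F, productForm L F ^ 2 = (L.map fun A => (A.card : ℝ)).prod := by
  induction L with
  | nil => simp [productForm, Pi.single_apply]
  | cons A L ih =>
    obtain ⟨hA, hL⟩ := List.pairwise_cons.mp hL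
    rw [List.map_cons, List.prod_cons, ← ih hL, productForm, sum_wedge_sq, sum_vertexForm_sq]
    funext G
    refine Finset.sum_eq_zero fun v hv => ?_
    by_contra hne
    obtain ⟨B, hB, hvB⟩ := (isTransversal_of_productForm_ne_zero
      (right_ne_zero_of_mul hne)).exists_mem (Finset.mem_insert_self v G)
    simp [vertexForm, Finset.disjoint_right.mp (hA B hB) hvB] at hne

/-- The vertices that lie in no set of the list. -/
def remainder (L : List (Finset V)) : Finset V := Finset.univ.filter fun v => ∀ A ∈ L, v ∉ A

theorem disjoint_remainder {L : List (Finset V)} {A : Finset V} (hA : A ∈ L) :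
    Disjoint (remainder L) A :=
  Finset.disjoint_left.mpr fun _ hv => (Finset.mem_filter.mp hv).2 A hA

theorem card_remainder {L : List (Finset V)} (hL : L.Pairwise Disjoint) :
    ((remainder L).card : ℝ) = Fintype.card V - (L.map fun A => (A.card : ℝ)).sum := by
  induction L with
  | nil => simp [remainder]
  | cons A L ih =>
    obtain ⟨hA, hL⟩ := List.pairwise_cons.mp hL
    have h : remainder L = (remainder (A :: L)).disjUnion A (disjoint_remainder (by simp)) := by
      ext v
      simp only [remainder, Finset.mem_filter, Finset.mem_univ, true_and, List.mem_cons,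
        forall_eq_or_imp, Finset.mem_disjUnion]
      constructor
      · intro h
        by_cases hv : v ∈ A
        · exact Or.inr hv
        · exact Or.inl ⟨hv, h⟩
      · rintro (h | h)
        · exact h.2
        · exact fun B hB => Finset.disjoint_left.mp (hA B hB) h
    have h' := ih hL
    rw [h, Finset.card_disjUnion] at h'
    push_cast at h'
    rw [List.map_cons, List.sum_cons]
    linarith

theorem vertexForm_remainder {L : List (Finset V)} {A : Finset V} (hA : ∀ B ∈ L, Disjoint A B) :
    vertexForm (remainder L) = vertexForm (remainder (A :: L)) + vertexForm A := by
  funext v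
  simp only [vertexForm, remainder, Finset.mem_filter, Finset.mem_univ, true_and, List.mem_cons,
    forall_eq_or_imp, Pi.add_apply]
  by_cases hv : v ∈ A
  · have : ∀ B ∈ L, v ∉ B := fun B hB => Finset.disjoint_left.mp (hA B hB) hv
    simpa [hv] using this
  · simp [hv]

theorem wedge_one_eq_wedge_remainder {L : List (Finset V)} (hL : L.Pairwise Disjoint)
    {φ : Finset V → ℝ} (hφ : ∀ A ∈ L, wedge (vertexForm A) φ = 0) :
    wedge 1 φ = wedge (vertexForm (remainder L)) φ := by
  induction L with
  | nil =>
    congr 1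
    funext v
    simp [vertexForm, remainder]
  | cons A L ih =>
    obtain ⟨hA, hL⟩ := List.pairwise_cons.mp hL
    rw [ih hL fun B hB => hφ B (by simp [hB]), vertexForm_remainder hA, wedge_add_left,
      hφ A (by simp), add_zero]

theorem wedge_one_productForm {L : List (Finset V)} (hL : L.Pairwise Disjoint) :
    wedge 1 (productForm L) = productForm (remainder L :: L) :=
  wedge_one_eq_wedge_remainder hL fun _ => wedge_vertexForm_productForm

theorem sum_wedge_one_productForm_sq {L : List (Finset V)} (hL : L.Pairwise Disjoint) {a : ℕ}
    (ha : ∀ A ∈ L, A.card = a) :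
    ∑ F, wedge 1 (productForm L) F ^ 2 = (Fintype.card V - L.length * a) * (a : ℝ) ^ L.length := by
  have hmap : L.map (fun A => (A.card : ℝ)) = List.replicate L.length (a : ℝ) := by
    rw [List.eq_replicate_iff]
    refine ⟨by simp, fun b hb => ?_⟩
    obtain ⟨A, hA, rfl⟩ := List.mem_map.mp hb
    rw [ha A hA]
  rw [wedge_one_productForm hL, sum_productForm_sq
      (List.pairwise_cons.mpr ⟨fun A hA => disjoint_remainder hA, hL⟩), List.map_cons,
    List.prod_cons, card_remainder hL, hmap, List.prod_replicate, List.sum_replicate, nsmul_eq_mul]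

/-- Both coboundaries contain, with opposite signs, the product form of the whole list
`B :: A :: L`; the other terms have disjoint supports. -/
theorem wedge_one_productForm_mul {A B : Finset V} {L : List (Finset V)}
    (hL : (B :: A :: L).Pairwise Disjoint) (F : Finset V) :
    wedge 1 (productForm (A :: L)) F * wedge 1 (productForm (B :: L)) F =
      -productForm (B :: A :: L) F ^ 2 := by
  obtain ⟨hB, hAL⟩ := List.pairwise_cons.mp hL
  obtain ⟨hA, hL'⟩ := List.pairwise_cons.mp hAL
  have hBA : Disjoint B A := hB A (by simp)
  have hB' : ∀ C ∈ L, Disjoint B C := fun C hC => hB C (by simp [hC])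
  have hA' : ∀ C ∈ B :: L, Disjoint A C := by
    intro C hC
    rcases List.mem_cons.mp hC with rfl | hC
    · exact hBA.symm
    · exact hA C hC
  have hBL : (B :: L).Pairwise Disjoint := List.pairwise_cons.mpr ⟨hB', hL'⟩
  have h1 : wedge 1 (productForm (A :: L)) =
      productForm (remainder (B :: A :: L) :: A :: L) + productForm (B :: A :: L) := by
    rw [wedge_one_eq_wedge_remainder hAL fun _ => wedge_vertexForm_productForm,
      vertexForm_remainder hB, wedge_add_left]
    rfl
  have h2 : wedge 1 (productForm (B :: L)) =
      productForm (remainder (A :: B :: L) :: B :: L) - productForm (B :: A :: L) := by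
    rw [wedge_one_eq_wedge_remainder hBL fun _ => wedge_vertexForm_productForm,
      vertexForm_remainder hA', wedge_add_left, sub_eq_add_neg]
    congr 1
    exact wedge_wedge_comm _ _ _
  have h3 : ∀ v, productForm (remainder (B :: A :: L) :: A :: L) F ≠ 0 → v ∈ F → v ∉ B := by
    intro v h hv hvB
    obtain ⟨C, hC, hvC⟩ := (isTransversal_of_productForm_ne_zero h).exists_mem hv
    rcases List.mem_cons.mp hC with rfl | hC
    · exact Finset.disjoint_left.mp (disjoint_remainder (by simp)) hvC hvB
    · exact Finset.disjoint_left.mp (hB C hC) hvB hvC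
  have h4 : productForm (remainder (B :: A :: L) :: A :: L) F = 0 ∨
      productForm (remainder (A :: B :: L) :: B :: L) F = 0 := by
    by_contra! h
    obtain ⟨v, hv, hvB⟩ := (isTransversal_of_productForm_ne_zero h.2).exists_mem_of_mem
      (A := B) (by simp)
    exact h3 v h.1 hv hvB
  have h5 : productForm (remainder (B :: A :: L) :: A :: L) F = 0 ∨
      productForm (B :: A :: L) F = 0 := by
    by_contra! h
    obtain ⟨v, hv, hvB⟩ := (isTransversal_of_productForm_ne_zero h.2).exists_mem_of_mem
      (A := B) (by simp)
    exact h3 v h.1 hv hvB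
  have h6 : productForm (B :: A :: L) F = 0 ∨
      productForm (remainder (A :: B :: L) :: B :: L) F = 0 := by
    by_contra! h
    obtain ⟨v, hv, hvR⟩ := (isTransversal_of_productForm_ne_zero h.2).exists_mem_of_mem
      (A := remainder (A :: B :: L)) (by simp)
    obtain ⟨C, hC, hvC⟩ := (isTransversal_of_productForm_ne_zero h.1).exists_mem hv
    exact (Finset.mem_filter.mp hvR).2 C ((List.Perm.swap A B L).mem_iff.mp hC) hvC
  rw [h1, h2, Pi.add_apply, Pi.sub_apply]
  linear_combination (mul_eq_zero.mpr h4) - (mul_eq_zero.mpr h5) + (mul_eq_zero.mpr h6)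

end ProductForm

open Classical in
/-- The lower bound of the expander mixing lemma for `d + 1` disjoint sets of equal size `a`. The
error is `ε * (n - d * a)` and not `ε * n`, because only the projections of the product forms to the
space of cycles contribute to it. -/
theorem card_transversal_cells_ge {V : Type*} [LinearOrder V] [Fintype V] [Nonempty V]
    (X : AbstractSimplicialComplex V) {A B : Finset V} {L : List (Finset V)}
    (hL : (B :: A :: L).Pairwise Disjoint) {a : ℕ} (ha : ∀ C ∈ B :: A :: L, C.card = a)
    {d : ℕ} (hd : d = L.length + 1) (hskel : X.HasCompleteSkeleton ((d : ℤ) - 1)) {k ε : ℝ}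
    (hspec : X.cycleSpectrum ((d : ℤ) - 1) ⊆ Set.Icc (k - ε) (k + ε)) :
    (a : ℝ) ^ d * (k * a - ε * (Fintype.card V - d * a)) / Fintype.card V ≤
      ((X.cells d).filter fun F => IsTransversal (B :: A :: L) F).card := by
  obtain ⟨hB, hAL⟩ := List.pairwise_cons.mp hL
  have hBL : (B :: L).Pairwise Disjoint := hL.sublist (by simp)
  have haA : ∀ C ∈ A :: L, C.card = a := fun C hC => ha C (List.mem_cons_of_mem B hC)
  have haB : ∀ C ∈ B :: L, C.card = a := fun C hC => by
    rcases List.mem_cons.mp hC with rfl | hC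
    · exact ha _ (by simp)
    · exact ha C (by simp [hC])
  have hsq : ∀ F, productForm (B :: A :: L) F ^ 2 =
      if IsTransversal (B :: A :: L) F then 1 else 0 := by
    intro F
    split_ifs with h
    · exact productForm_sq_of_isTransversal hL h
    · by_contra hne
      exact h (isTransversal_of_productForm_ne_zero fun h0 => hne (by simp [h0]))
  have hall : ∑ F, productForm (B :: A :: L) F ^ 2 = (a : ℝ) ^ (d + 1) := by
    rw [sum_productForm_sq hL, List.prod_eq_pow_card _ (a : ℝ)]
    · simp [hd]
    · intro b hb
      obtain ⟨C, hC, rfl⟩ := List.mem_map.mp hb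
      rw [ha C hC]
  have h := X.abs_sum_cells_wedge_sub_le hskel hspec
    (φ := productForm (A :: L)) (ψ := productForm (B :: L))
    (fun G hG => productForm_eq_zero_of_card (by simpa [hd] using hG))
    (fun G hG => productForm_eq_zero_of_card (by simpa [hd] using hG))
  simp only [wedge_one_productForm_mul hL] at h
  rw [sum_wedge_one_productForm_sq hAL haA, sum_wedge_one_productForm_sq hBL haB] at h
  simp only [List.length_cons, ← hd, Finset.sum_neg_distrib, hall] at h
  have hcard : ∑ F ∈ X.cells d, productForm (B :: A :: L) F ^ 2 =
      ((X.cells d).filter fun F => IsTransversal (B :: A :: L) F).card := by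
    simp only [hsq]
    rw [Finset.sum_boole]
  have hnonneg : (0 : ℝ) ≤ (Fintype.card V - d * a) * (a : ℝ) ^ d := by
    have := sum_wedge_one_productForm_sq hAL haA
    rw [List.length_cons, ← hd] at this
    rw [← this]
    exact Finset.sum_nonneg fun _ _ => sq_nonneg _
  rw [hcard, Real.mul_self_sqrt hnonneg] at h
  have h' := (abs_le.mp h).2
  have hn0 : (0 : ℝ) < Fintype.card V := by exact_mod_cast Fintype.card_pos
  calc _ = k / Fintype.card V * (a : ℝ) ^ (d + 1) -
        ε / Fintype.card V * ((Fintype.card V - d * a) * (a : ℝ) ^ d) := by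
        field_simp
        ring
    _ ≤ _ := by linarith

end AbstractSimplicialComplex

namespace Pach

/-! ### Points in general position -/

/-- The homogeneous coordinates `(1, x)` of the points of a family. -/
def homogeneousMatrix {d : ℕ} (p : Fin (d + 1) → EuclideanSpace ℝ (Fin d)) :
    Matrix (Fin (d + 1)) (Fin (d + 1)) ℝ :=
  Matrix.of fun i => Fin.cons 1 (p i)

theorem affineIndependent_of_det_ne_zero {d : ℕ} {p : Fin (d + 1) → EuclideanSpace ℝ (Fin d)}
    (h : (homogeneousMatrix p).det ≠ 0) : AffineIndependent ℝ p := by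
  rw [affineIndependent_iff_of_fintype]
  intro w hw hwp i
  rw [Finset.weightedVSub_eq_linear_combination Finset.univ hw] at hwp
  have h0 : Matrix.vecMul w (homogeneousMatrix p) = 0 := by
    funext j
    refine Fin.cases ?_ (fun j => ?_) j
    · simpa [homogeneousMatrix, Matrix.vecMul, dotProduct] using hw
    · have := congrArg (fun v : EuclideanSpace ℝ (Fin d) => v j) hwp
      simpa [homogeneousMatrix, Matrix.vecMul, dotProduct] using this
  exact congrFun (Matrix.eq_zero_of_vecMul_eq_zero h h0) i

/-- The point with parameter `t` of the moment curve. -/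
noncomputable def momentCurve (d : ℕ) (t : ℝ) : EuclideanSpace ℝ (Fin d) :=
  WithLp.toLp 2 fun j => t ^ (j + 1 : ℕ)

theorem homogeneousMatrix_momentCurve {d : ℕ} (t : Fin (d + 1) → ℝ) :
    homogeneousMatrix (fun i => momentCurve d (t i)) = Matrix.vandermonde t := by
  ext i j
  refine Fin.cases ?_ (fun j => ?_) j <;> simp [homogeneousMatrix, momentCurve, Matrix.vandermonde]

open Polynomial in
/-- On the line from `p` to a family `q` with independent homogeneous coordinates, only finitely
many families are affinely dependent: the determinant is a polynomial that does not vanish at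
`t = 1`. -/
theorem finite_setOf_det_eq_zero {d : ℕ} (p q : Fin (d + 1) → EuclideanSpace ℝ (Fin d))
    (hq : (homogeneousMatrix q).det ≠ 0) :
    {t : ℝ | (homogeneousMatrix fun i => p i + t • (q i - p i)).det = 0}.Finite := by
  let M : Matrix (Fin (d + 1)) (Fin (d + 1)) ℝ[X] := Matrix.of fun i j =>
    C (homogeneousMatrix p i j) + X * C (homogeneousMatrix q i j - homogeneousMatrix p i j)
  have heval : ∀ t : ℝ, (homogeneousMatrix fun i => p i + t • (q i - p i)).det = M.det.eval t := by
    intro t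
    rw [← Polynomial.coe_evalRingHom, RingHom.map_det]
    congr 1
    ext i j
    refine Fin.cases ?_ (fun j => ?_) j <;> simp [M, homogeneousMatrix]
  have hM : M.det ≠ 0 := by
    intro h0
    have h1 := heval 1
    rw [h0, eval_zero] at h1
    exact hq (by simpa using h1)
  refine (M.det.roots.toFinset.finite_toSet).subset fun t ht => ?_
  have ht' : (homogeneousMatrix fun i => p i + t • (q i - p i)).det = 0 := ht
  simp only [Finset.mem_coe, Multiset.mem_toFinset, mem_roots hM, IsRoot.def]
  rw [← heval, ht']

theorem image_preimage_of_subset_range {α β : Type*} [DecidableEq β] {f : α → β}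
    (hf : Function.Injective f) {s : Finset β} (hs : (s : Set β) ⊆ Set.range f) :
    (s.preimage f hf.injOn).image f = s := by
  rw [← Finset.coe_inj, Finset.coe_image, Finset.coe_preimage,
    Set.image_preimage_eq_of_subset hs]

/-- Every finite family of points has arbitrarily small perturbations to general position: move the
points slightly towards distinct points of the moment curve. -/
theorem exists_generalPosition_near {V : Type*} [Fintype V] {d : ℕ} (hn : d < Fintype.card V)
    (hd : 1 ≤ d) (φ : V → EuclideanSpace ℝ (Fin d)) {r : ℝ} (hr : 0 < r) :
    ∃ φ' : V → EuclideanSpace ℝ (Fin d), Function.Injective φ' ∧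
      GeneralPosition (Set.range φ') ∧ ∀ v, dist (φ' v) (φ v) ≤ r := by
  classical
  let q : V → EuclideanSpace ℝ (Fin d) := fun v => momentCurve d (Fintype.equivFin V v : ℕ)
  have hq : ∀ e : Fin (d + 1) → V, Function.Injective e →
      (homogeneousMatrix fun i => q (e i)).det ≠ 0 := by
    intro e he
    rw [homogeneousMatrix_momentCurve, Matrix.det_vandermonde_ne_zero_iff]
    intro i j hij
    exact he ((Fintype.equivFin V).injective (Fin.ext (Nat.cast_injective hij)))
  have hfin : {t : ℝ | ∃ e : Fin (d + 1) → V, Function.Injective e ∧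
      (homogeneousMatrix fun i => φ (e i) + t • (q (e i) - φ (e i))).det = 0}.Finite := by
    have : {t : ℝ | ∃ e : Fin (d + 1) → V, Function.Injective e ∧
        (homogeneousMatrix fun i => φ (e i) + t • (q (e i) - φ (e i))).det = 0} =
        ⋃ e ∈ {e : Fin (d + 1) → V | Function.Injective e},
          {t : ℝ | (homogeneousMatrix fun i => φ (e i) + t • (q (e i) - φ (e i))).det = 0} := by
      ext t
      simp
    rw [this]
    exact (Set.toFinite _).biUnion fun e he => finite_setOf_det_eq_zero _ _ (hq e he)
  obtain ⟨K, hK0, hK⟩ : ∃ K : ℝ, 0 < K ∧ ∀ v, ‖q v - φ v‖ ≤ K := by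
    obtain ⟨K, hK⟩ := (Set.finite_range fun v => ‖q v - φ v‖).bddAbove
    exact ⟨max K 1, by positivity, fun v => (hK ⟨v, rfl⟩).trans (le_max_left _ _)⟩
  obtain ⟨t, ⟨ht0, htK⟩, ht⟩ := ((Set.Ioo_infinite (div_pos hr hK0)).sdiff hfin).nonempty
  let φ' : V → EuclideanSpace ℝ (Fin d) := fun v => φ v + t • (q v - φ v)
  have hind : ∀ e : Fin (d + 1) → V, Function.Injective e →
      AffineIndependent ℝ (fun i => φ' (e i)) := fun e he =>
    affineIndependent_of_det_ne_zero fun h0 => ht ⟨e, he, h0⟩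
  have hindS : ∀ S : Finset V, S.card ≤ d + 1 → AffineIndependent ℝ fun v : S => φ' v := by
    intro S hS
    obtain ⟨S', hSS', -, hS'⟩ := Finset.exists_subsuperset_card_eq (Finset.subset_univ S) hS
      (by rw [Finset.card_univ]; omega)
    have e := (S'.equivFinOfCardEq hS')
    have h1 := hind (fun i => (e.symm i).1) (Subtype.val_injective.comp e.symm.injective)
    have h2 := h1.comp_embedding
      (⟨fun v : S => e ⟨v.1, hSS' v.2⟩, fun u v h => Subtype.ext (by simpa using h)⟩ :
        S ↪ Fin (d + 1))
    convert h2 using 2 with v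
    change φ' v = φ' (e.symm (e ⟨v.1, _⟩))
    rw [Equiv.symm_apply_apply]
  have hinj : Function.Injective φ' := by
    intro u v huv
    by_contra hne
    have h := (hindS {u, v} ((Finset.card_le_two).trans (by omega))).injective
      (a₁ := ⟨u, by simp⟩) (a₂ := ⟨v, by simp⟩) huv
    exact hne (congrArg Subtype.val h)
  refine ⟨φ', hinj, ?_, fun v => ?_⟩
  · intro T hT hTc
    obtain ⟨S, hS, rfl⟩ : ∃ S : Finset V, S.card = T.card ∧ S.image φ' = T := by
      have h := image_preimage_of_subset_range hinj hT
      exact ⟨_, by rw [← Finset.card_image_of_injective _ hinj, h], h⟩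
    refine ((hindS S (hS ▸ hTc)).range).mono ?_
    intro x hx
    obtain ⟨v, hv, rfl⟩ := Finset.mem_image.mp (Finset.mem_coe.mp hx)
    exact ⟨⟨v, hv⟩, rfl⟩
  · simp only [φ', dist_self_add_left, norm_smul, Real.norm_eq_abs, abs_of_pos ht0]
    calc t * ‖q v - φ v‖ ≤ r / K * K := by gcongr; exact hK v
      _ = r := div_mul_cancel₀ _ hK0.ne'

/-! ### Pach's theorem for arbitrary point configurations -/

theorem mem_cthickening_convexHull {d m : ℕ} {p p' : Fin m → EuclideanSpace ℝ (Fin d)} {r : ℝ}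
    (hp : ∀ i, dist (p' i) (p i) ≤ r) {z : EuclideanSpace ℝ (Fin d)}
    (hz : z ∈ convexHull ℝ (Set.range p')) :
    z ∈ Metric.cthickening r (convexHull ℝ (Set.range p)) := by
  have hconv : Convex ℝ (Metric.cthickening r (convexHull ℝ (Set.range p))) :=
    (convex_convexHull ℝ _).cthickening r
  refine convexHull_min ?_ hconv hz
  rintro _ ⟨i, rfl⟩
  exact Metric.mem_cthickening_of_dist_le _ (p i) r _ (subset_convexHull ℝ _ ⟨i, rfl⟩) (hp i)

/-- Pach's theorem without general position: perturb the points and pass to the limit, the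
subsets being constant along a subsequence. -/
theorem exists_point_and_subsets {V : Type*} [Fintype V] [DecidableEq V] {d : ℕ} {c : ℝ}
    (hc : IsAdmissible d c) (hn : d < Fintype.card V) (hd : 1 ≤ d)
    (φ : V → EuclideanSpace ℝ (Fin d)) (P : Fin (d + 1) → Finset V)
    (hP : Pairwise fun i j => Disjoint (P i) (P j)) :
    ∃ (z : EuclideanSpace ℝ (Fin d)) (Q : Fin (d + 1) → Finset V),
      (∀ i, Q i ⊆ P i) ∧ (∀ i, c * ((P i).card : ℝ) ≤ (Q i).card) ∧
        ∀ x : Fin (d + 1) → V, (∀ i, x i ∈ Q i) → z ∈ convexHull ℝ (Set.range (φ ∘ x)) := by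
  classical
  let r : ℕ → ℝ := fun j => 1 / ((j : ℝ) + 1)
  have hr : ∀ j, 0 < r j := fun j => Nat.one_div_pos_of_nat
  have hstep : ∀ j : ℕ, ∃ Q : Fin (d + 1) → Finset V, (∀ i, Q i ⊆ P i) ∧
      (∀ i, c * ((P i).card : ℝ) ≤ (Q i).card) ∧ ∃ z : EuclideanSpace ℝ (Fin d),
        ∀ x : Fin (d + 1) → V, (∀ i, x i ∈ Q i) →
          z ∈ Metric.cthickening (r j) (convexHull ℝ (Set.range (φ ∘ x))) := by
    intro j
    obtain ⟨φ', hinj, hgen, hdist⟩ := exists_generalPosition_near hn hd φ (hr j)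
    obtain ⟨z, Q, hQP, hQc, hz⟩ := hc (fun i => (P i).image φ')
      (fun i i' h => (Finset.disjoint_image hinj).mpr (hP h))
      (fun T hT => hgen T (hT.trans (Set.iUnion_subset fun i => by
        rw [Finset.coe_image]
        exact Set.image_subset_range _ _)))
    have himg : ∀ i, ((Q i).preimage φ' hinj.injOn).image φ' = Q i := fun i =>
      image_preimage_of_subset_range hinj (fun x hx => by
        obtain ⟨v, -, rfl⟩ := Finset.mem_image.mp (hQP i hx)
        exact ⟨v, rfl⟩)
    refine ⟨fun i => (Q i).preimage φ' hinj.injOn, fun i v hv => ?_, fun i => ?_, z, fun x hx => ?_⟩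
    · obtain ⟨u, hu, huv⟩ := Finset.mem_image.mp (hQP i (Finset.mem_preimage.mp hv))
      exact hinj huv ▸ hu
    · have := hQc i
      rwa [Finset.card_image_of_injective _ hinj, ← himg i,
        Finset.card_image_of_injective _ hinj] at this
    · exact mem_cthickening_convexHull (p' := φ' ∘ x) (fun i => hdist (x i))
        (hz (φ' ∘ x) fun i => (Finset.mem_preimage (hf := hinj.injOn)).mp (hx i))
  choose Q hQP hQc z hz using hstep
  obtain ⟨Q', hfreq⟩ : ∃ Q', ∃ᶠ j in Filter.atTop, Q j = Q' := by
    by_contra! hcon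
    have hall := Filter.eventually_all.mpr hcon
    obtain ⟨j, hj⟩ := hall.exists
    exact hj (Q j) rfl
  obtain ⟨j₀, hj₀⟩ := hfreq.exists
  let K : (Fin (d + 1) → V) → Set (EuclideanSpace ℝ (Fin d)) :=
    fun x => convexHull ℝ (Set.range (φ ∘ x))
  have hKc : ∀ x, IsCompact (K x) := fun x => (Set.finite_range _).isCompact_convexHull ℝ
  suffices h : ∃ z, ∀ x : Fin (d + 1) → V, (∀ i, x i ∈ Q' i) → z ∈ K x by
    obtain ⟨z, hz⟩ := h
    exact ⟨z, Q', hj₀ ▸ hQP j₀, hj₀ ▸ hQc j₀, hz⟩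
  by_cases hne : ∃ x : Fin (d + 1) → V, ∀ i, x i ∈ Q' i
  · obtain ⟨x₀, hx₀⟩ := hne
    let S : ℕ → Set (EuclideanSpace ℝ (Fin d)) := fun j =>
      ⋂ x ∈ {x : Fin (d + 1) → V | ∀ i, x i ∈ Q' i}, Metric.cthickening (r j) (K x)
    have hSclosed : ∀ j, IsClosed (S j) := fun j =>
      isClosed_biInter fun x _ => Metric.isClosed_cthickening
    have hrm : ∀ {i j : ℕ}, i ≤ j → r j ≤ r i := fun h => Nat.one_div_le_one_div h
    have hSanti : ∀ {i j : ℕ}, i ≤ j → S j ⊆ S i := fun h =>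
      Set.iInter₂_mono fun x _ => Metric.cthickening_mono (hrm h) _
    have hSne : ∀ j, (S j).Nonempty := by
      intro j
      obtain ⟨i, hij, hi⟩ := Filter.frequently_atTop.mp hfreq j
      exact ⟨z i, hSanti hij (Set.mem_iInter₂.mpr fun x hx => hz i x (by rw [hi]; exact hx))⟩
    have hScomp : IsCompact (S 0) :=
      ((hKc x₀).cthickening).of_isClosed_subset (hSclosed 0) (Set.biInter_subset_of_mem hx₀)
    obtain ⟨z', hz'⟩ := IsCompact.nonempty_iInter_of_sequence_nonempty_isCompact_isClosed S
      (fun j => hSanti (Nat.le_succ j)) hSne hScomp hSclosed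
    refine ⟨z', fun x hx => ?_⟩
    rw [← (hKc x).isClosed.closure_eq, Metric.closure_eq_iInter_cthickening]
    refine Set.mem_iInter₂.mpr fun δ hδ => ?_
    obtain ⟨j, hj⟩ := exists_nat_one_div_lt hδ
    exact Metric.cthickening_mono hj.le _ (Set.mem_iInter₂.mp (Set.mem_iInter.mp hz' j) x hx)
  · exact ⟨0, fun x hx => absurd ⟨x, hx⟩ hne⟩

end Pach

namespace AbstractSimplicialComplex

/-! ### Points covered by simplices -/

theorem nonempty_preimage_inter_simplex {V : Type*} [Fintype V] {d : ℕ}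
    (X : AbstractSimplicialComplex V) (φ : V → EuclideanSpace ℝ (Fin d)) {F : Finset V}
    (hF : X.IsFace F) {z : EuclideanSpace ℝ (Fin d)} (hz : z ∈ convexHull ℝ (φ '' F)) :
    (X.geometricExtension φ ⁻¹' {z} ∩ X.simplex F).Nonempty := by
  classical
  have himg : φ '' F =
      Fintype.linearCombination ℝ φ '' ((fun v => Pi.single v (1 : ℝ)) '' (F : Set V)) := by
    rw [Set.image_image]
    exact Set.image_congr fun v _ => by simp [Fintype.linearCombination_apply_single]
  rw [himg, ← LinearMap.image_convexHull] at hz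
  obtain ⟨w, hw, hwz⟩ := hz
  have hsub : convexHull ℝ ((fun v => Pi.single v (1 : ℝ)) '' (F : Set V)) ⊆
      stdSimplex ℝ V ∩ {w | ∀ v, v ∉ F → w v = 0} := by
    refine convexHull_min ?_ ((convex_stdSimplex ℝ V).inter ?_)
    · rintro _ ⟨v, hv, rfl⟩
      refine ⟨single_mem_stdSimplex ℝ v, fun u hu => Pi.single_eq_of_ne ?_ _⟩
      rintro rfl
      exact hu hv
    · intro x hx y hy a b _ _ _ v hv
      simp [hx v hv, hy v hv]
  obtain ⟨hw1, hw2⟩ := hsub hw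
  refine ⟨⟨w, hw1, hF.mono fun v hv => ?_⟩, ?_, hw2⟩
  · by_contra hvF
    exact (Finset.mem_filter.mp hv).2 (hw2 v hvF)
  · exact hwz

/-! ### Numerical estimates -/

theorem add_one_pow_le_exp_mul_factorial (d : ℕ) :
    ((d : ℝ) + 1) ^ d ≤ Real.exp 1 ^ d * d.factorial := by
  induction d with
  | zero => simp
  | succ d ih =>
    have h1 : (1 + 1 / ((d : ℝ) + 1)) ^ (d + 1) ≤ Real.exp 1 := by
      calc (1 + 1 / ((d : ℝ) + 1)) ^ (d + 1) ≤ Real.exp (1 / ((d : ℝ) + 1)) ^ (d + 1) := by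
            gcongr
            rw [add_comm]
            exact Real.add_one_le_exp _
        _ = Real.exp 1 := by
            rw [← Real.exp_nat_mul]
            congr 1
            push_cast
            field_simp
    have h2 : ((d : ℝ) + 1 + 1) = (d + 1) * (1 + 1 / ((d : ℝ) + 1)) := by
      field_simp
    rw [Nat.factorial_succ]
    push_cast
    rw [h2, mul_pow]
    calc ((d : ℝ) + 1) ^ (d + 1) * (1 + 1 / ((d : ℝ) + 1)) ^ (d + 1)
        ≤ ((d : ℝ) + 1) ^ (d + 1) * Real.exp 1 := by gcongr
      _ = ((d : ℝ) + 1) ^ d * ((d + 1) * Real.exp 1) := by ring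
      _ ≤ (Real.exp 1 ^ d * d.factorial) * ((d + 1) * Real.exp 1) := by gcongr
      _ = _ := by ring

theorem choose_le_exp_mul_pow {n d q : ℕ} (hq : n ≤ q * (d + 1) + d)
    (hn : (d : ℝ) * (d + 1) ≤ n - d) :
    (n.choose d : ℝ) ≤ Real.exp 1 ^ (d + 1) * (q : ℝ) ^ d := by
  have hq' : (n : ℝ) - d ≤ q * (d + 1) := by
    have : (n : ℝ) ≤ q * (d + 1) + d := by exact_mod_cast hq
    linarith
  have h1 : (n : ℝ) ≤ q * (d + 1) * (1 + 1 / ((d : ℝ) + 1)) := by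
    calc (n : ℝ) = (n - d) + d := by ring
      _ ≤ (n - d) + (n - d) / (d + 1) := by
        gcongr
        rw [le_div_iff₀ (by positivity)]
        exact hn
      _ = (n - d) * (1 + 1 / ((d : ℝ) + 1)) := by ring
      _ ≤ _ := by gcongr
  have h2 : (1 + 1 / ((d : ℝ) + 1)) ^ d ≤ Real.exp 1 := by
    calc (1 + 1 / ((d : ℝ) + 1)) ^ d ≤ Real.exp (1 / ((d : ℝ) + 1)) ^ d := by
          gcongr
          rw [add_comm]
          exact Real.add_one_le_exp _
      _ ≤ Real.exp 1 := by
          rw [← Real.exp_nat_mul]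
          gcongr
          rw [mul_one_div, div_le_one (by positivity)]
          linarith
  have h3 := add_one_pow_le_exp_mul_factorial d
  have hf : (0 : ℝ) < d.factorial := by exact_mod_cast d.factorial_pos
  calc (n.choose d : ℝ) ≤ (n : ℝ) ^ d / d.factorial := Nat.choose_le_pow_div d n
    _ ≤ (q * (d + 1) * (1 + 1 / ((d : ℝ) + 1))) ^ d / d.factorial := by gcongr
    _ = (q : ℝ) ^ d * ((d + 1 : ℝ) ^ d * (1 + 1 / ((d : ℝ) + 1)) ^ d) / d.factorial := by
      rw [mul_pow, mul_pow, mul_assoc]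
    _ ≤ (q : ℝ) ^ d * ((Real.exp 1 ^ d * d.factorial) * Real.exp 1) / d.factorial := by gcongr
    _ = _ := by
      field_simp
      ring

/-- The loss from rounding the size of the parts to `q` is compensated by the projection term
`ε * d * a`, because `ε * (n - d) ≥ k * d`. -/
theorem overlap_bound_le {n k ε c q a M C E : ℝ} {d : ℕ} (hd : 1 ≤ d) (hn : (d : ℝ) < n)
    (hk : 0 < k) (hc : 0 ≤ c) (hq : 0 ≤ q) (hE : 0 < E) (htrace : k * d ≤ ε * (n - d))
    (hpos : 0 ≤ c - ε * (d + 1) / k) (ha : c * q ≤ a) (hqn : n ≤ q * (d + 1) + d)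
    (hC : C ≤ E * q ^ d) (hM : (d + 1) * M = k * C) :
    c ^ d / E * (c - ε * (d + 1) / k) * M ≤ a ^ d * (k * a - ε * (n - d * a)) / n := by
  have hd' : (1 : ℝ) ≤ d := by exact_mod_cast hd
  have hn0 : 0 < n := by linarith
  have hε : 0 ≤ ε := by
    refine nonneg_of_mul_nonneg_left (le_trans ?_ htrace) (by linarith : 0 < n - d)
    positivity
  have hy : 0 ≤ c * k - ε * (d + 1) := by
    have := mul_nonneg hpos hk.le
    rwa [sub_mul, div_mul_cancel₀ _ hk.ne'] at this
  have hM' : M = k * C / (d + 1) := by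
    rw [eq_div_iff (by positivity), ← hM]
    ring
  have hcq : 0 ≤ c * q := mul_nonneg hc hq
  have ha0 : 0 ≤ a := hcq.trans ha
  have hbracket : (c * k - ε * (d + 1)) / (d + 1) ≤ (k * a - ε * (n - d * a)) / n := by
    rw [div_le_div_iff₀ (by positivity) hn0]
    have h1 : c * (k * n) ≤ c * ((k + ε * d) * (q * (d + 1))) := by
      refine mul_le_mul_of_nonneg_left ?_ hc
      calc k * n ≤ k * n + k * d * (d - 1) := by
            have : 0 ≤ k * d * (d - 1) := by
              have : (0 : ℝ) ≤ d - 1 := by linarith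
              positivity
            linarith
        _ = k * (n - d) + d * (k * d) := by ring
        _ ≤ k * (n - d) + d * (ε * (n - d)) := by gcongr
        _ = (k + ε * d) * (n - d) := by ring
        _ ≤ _ := by
            refine mul_le_mul_of_nonneg_left (by linarith) ?_
            positivity
    have h2 : (k + ε * d) * (d + 1) * (c * q) ≤ (k + ε * d) * (d + 1) * a := by gcongr
    linarith
  calc c ^ d / E * (c - ε * (d + 1) / k) * M
      = C * (c ^ d / E * ((c * k - ε * (d + 1)) / (d + 1))) := by
        rw [hM']
        field_simp
    _ ≤ E * q ^ d * (c ^ d / E * ((c * k - ε * (d + 1)) / (d + 1))) := by gcongr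
    _ = (c * q) ^ d * ((c * k - ε * (d + 1)) / (d + 1)) := by
        rw [mul_pow]
        field_simp
    _ ≤ a ^ d * ((k * a - ε * (n - d * a)) / n) := by gcongr
    _ = _ := by ring

theorem exists_disjoint_of_card_le {V : Type*} [Fintype V] [DecidableEq V] {m q : ℕ}
    (h : m * q ≤ Fintype.card V) :
    ∃ P : Fin m → Finset V, (Pairwise fun i j => Disjoint (P i) (P j)) ∧ ∀ i, (P i).card = q := by
  obtain ⟨f⟩ : Nonempty (Fin m × Fin q ↪ V) :=
    Function.Embedding.nonempty_of_card_le (by simpa using h)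
  refine ⟨fun i => Finset.univ.image fun j => f (i, j), fun i j hij => ?_, fun i => ?_⟩
  · refine Finset.disjoint_left.mpr fun v hv hv' => ?_
    obtain ⟨x, -, hx⟩ := Finset.mem_image.mp hv
    obtain ⟨y, -, hy⟩ := Finset.mem_image.mp hv'
    exact hij (congrArg Prod.fst (f.injective (hx.trans hy.symm)))
  · rw [Finset.card_image_of_injective _ fun x y hxy => congrArg Prod.snd (f.injective hxy)]
    simp

end AbstractSimplicialComplex

/-! ### Geometric overlap of complexes with concentrated spectrum -/

open AbstractSimplicialComplex in
theorem mainTheorem2 {V : Type*} [Fintype V] [LinearOrder V] (d : ℕ) (hd : 1 ≤ d)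
    (X : AbstractSimplicialComplex V) (hdim : X.HasDimension d)
    (hskel : X.HasCompleteSkeleton ((d : ℤ) - 1))
    (k : ℝ) (hk : k = X.averageDegree ((d : ℤ) - 1)) (ε : ℝ)
    (hspec : X.cycleSpectrum ((d : ℤ) - 1) ⊆ Set.Icc (k - ε) (k + ε)) :
    X.HasGeometricOverlap d
      (Pach.pachConstant d ^ d / Real.exp 1 ^ (d + 1) *
        (Pach.pachConstant d - ε * (d + 1) / k)) := by
  classical
  intro φ hφ
  set c := Pach.pachConstant d
  have hc := (Pach.isGreatest_pachConstant d).1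
  have hc0 : 0 ≤ c := (Pach.isGreatest_pachConstant d).2 (Pach.isAdmissible_zero d)
  -- For `c ≤ ε * (d + 1) / k` the claimed overlap is not positive. Otherwise `c ≤ 1` forces
  -- `k ≥ ε * (d + 1)`, which with `k * d ≤ ε * (n - d)` makes the vertex set large.
  rcases le_or_gt (c - ε * (d + 1) / k) 0 with hneg | hpos
  · refine ⟨0, le_trans ?_ (Nat.cast_nonneg _)⟩
    exact mul_nonpos_of_nonpos_of_nonneg
      (mul_nonpos_of_nonneg_of_nonpos (by positivity) hneg) (Nat.cast_nonneg _)
  obtain ⟨s, hs, hsc⟩ := hdim.2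
  have hn : d < Fintype.card V := by
    have := Finset.card_le_univ s
    omega
  have hn' : (d : ℝ) < Fintype.card V := by exact_mod_cast hn
  have hV : Nonempty V := Fintype.card_pos_iff.mp (by omega)
  have hcells := X.card_cells_mul hn.le hskel
  rw [← hk] at hcells
  have hk0 : 0 < k := by
    have h1 : 0 < (X.cells d).card := Finset.card_pos.mpr ⟨s, mem_cells.mpr ⟨hs, by omega⟩⟩
    have h2 : (0 : ℝ) < k * (Fintype.card V).choose d := by
      rw [← hcells]
      positivity
    exact pos_of_mul_pos_left h2 (Nat.cast_nonneg _)
  have htrace := X.averageDegree_mul_le hn hskel hk hspec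
  have hlarge : (d : ℝ) * (d + 1) ≤ Fintype.card V - d := by
    have h1 : ε * (d + 1) / k ≤ 1 := hpos.le |> sub_nonneg.mp |>.trans hc.le_one
    rw [div_le_one hk0] at h1
    have hd' : (0 : ℝ) < d := by exact_mod_cast hd
    have hε : 0 < ε := pos_of_mul_pos_left ((mul_pos hk0 hd').trans_le htrace) (by linarith)
    refine le_of_mul_le_mul_left ?_ hε
    nlinarith
  set q := Fintype.card V / (d + 1) with hq
  have hqn : Fintype.card V ≤ q * (d + 1) + d := by
    have h1 := Nat.div_add_mod' (Fintype.card V) (d + 1)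
    have h2 := Nat.mod_lt (Fintype.card V) (show d + 1 > 0 by omega)
    rw [← hq] at h1
    omega
  obtain ⟨P, hPdisj, hPcard⟩ := exists_disjoint_of_card_le (V := V) (m := d + 1) (q := q)
    (Nat.mul_div_le _ _)
  obtain ⟨z, Q, hQP, hQc, hz⟩ := Pach.exists_point_and_subsets hc hn hd φ P hPdisj
  -- All sets are shrunk to the size of the smallest one.
  obtain ⟨i₀, -, hi₀⟩ := Finset.exists_min_image Finset.univ (fun i => (Q i).card)
    ⟨0, Finset.mem_univ 0⟩
  choose Q' hQ' hQ'c using fun i => Finset.exists_subset_card_eq (hi₀ i (Finset.mem_univ i))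
  set a := (Q i₀).card
  have ha : c * q ≤ a := by
    have := hQc i₀
    rwa [hPcard] at this
  have hQ'disj : ∀ i j, i < j → Disjoint (Q' i) (Q' j) := fun i j hij =>
    (hPdisj hij.ne).mono ((hQ' i).trans (hQP i)) ((hQ' j).trans (hQP j))
  have hbound : (a : ℝ) ^ d * (k * a - ε * (Fintype.card V - d * a)) / Fintype.card V ≤
      ((X.cells d).filter fun F => IsTransversal (List.ofFn Q') F).card := by
    obtain ⟨m, rfl⟩ : ∃ m, d = m + 1 := ⟨d - 1, by omega⟩
    have hpair : (List.ofFn Q').Pairwise Disjoint := List.pairwise_ofFn.mpr fun i j => hQ'disj i j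
    have hcard : ∀ C ∈ List.ofFn Q', C.card = a := by
      intro C hC
      obtain ⟨i, rfl⟩ := (List.mem_ofFn' _ _).mp hC
      exact hQ'c i
    rw [List.ofFn_succ, List.ofFn_succ] at hpair hcard ⊢
    convert card_transversal_cells_ge X hpair hcard (d := m + 1) (by simp) hskel hspec
  refine ⟨z, ?_⟩
  have hE : 0 < Real.exp 1 ^ (d + 1) := by positivity
  refine (overlap_bound_le hd hn' hk0 hc0 (Nat.cast_nonneg q) hE htrace hpos.le ha
    (by exact_mod_cast hqn) (choose_le_exp_mul_pow hqn hlarge) hcells).trans (hbound.trans ?_)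
  refine Nat.cast_le.mpr (Finset.card_le_card fun F hF => ?_)
  obtain ⟨hFX, hFT⟩ := Finset.mem_filter.mp hF
  refine Finset.mem_filter.mpr ⟨hFX, ?_⟩
  obtain ⟨x, hx, rfl⟩ := hFT.exists_eq_image
  refine X.nonempty_preimage_inter_simplex φ (mem_cells.mp hFX).1 ?_
  have := hz x fun i => hQ' i (hx i)
  rwa [Set.range_comp, ← Set.image_univ, ← Finset.coe_univ, ← Finset.coe_image] at this
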